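/- Consider $k=k_F+k_S$ servers, each with an infinite first-come first-served queue: $k_F\ge 1$ fast servers with exponential service rate $\mu_F>0$ and $k_S\ge 1$ slow servers with exponential service rate $\mu_S>0$. Let $q_F=k_F/k$, $q_S=k_S/k$, and assume $\mu_Fq_F+\mu_Sq_S=1$. Jobs arrive in a Poisson process of rate $\lambda k$, $\lambda>0$, and are dispatched immediately. Let $1\le d_F\le k_F$, $1\le d_S\le k_S$ and $p_F,p_S\in[0,1]$. Under both JIQ-$(d_F,d_S)$ and JSQ-$(d_F,d_S)$ an arriving job queries $d_F$ fast and $d_S$ slow servers, chosen uniformly at random without replacement. If some queried fast server is idle, the job goes to an idle one of these. If all queried fast servers are busy and some queried slow server is idle, the job goes with probability $p_S$ to an idle queried slow server and with probability $1-p_S$ to a chosen queried fast server. If all queried servers are busy, the job goes with probability $p_F$ to a chosen queried fast server and with probability $1-p_F$ to a chosen queried slow server. Under JIQ the chosen server is uniformly random among the queried servers of its class; under JSQ it is one with the shortest queue among these. All ties are broken uniformly at random. The system is called stable if the continuous-time Markov chain of the numbers of jobs at the servers is positive recurrent on the set of states reachable from the empty state. A pair $(p_F,p_S)\in[0,1]^2$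 is called optimal if it minimizes, over $[0,1]^2$, the stationary mean response time $E[T]=E[N]/(\lambda k)$, where $N$ is the total number of jobs in the system under the stationary distribution, and $E[T]=\infty$ if there is no stationary distribution. (a) If $\lambda<1$, then under each of the two policies: for $p_S=1$, $p_F=\mu_Fq_F$ every state is reachable from the empty state and the system is stable; optimal pairs $(p_F,p_S)$ exist; and for every optimal pair the system is stable. (b) If $\lambda\ge 1$, the system is not stable under any dispatching policy that assigns each arriving job to a server with probabilities that depend on the current numbers of jobs at the servers. So both policy families achieve the maximal stability region $\lambda<1$. -/

import Mathlib

open scoped ENNReal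

noncomputable section

/-! ### Continuous-time Markov chains with bounded transition rates

A chain on a countable set is given by its transition rates `q x y`, `x ≠ y` (with `q x x = 0`).
-/

namespace Chain

variable {S : Type} [DecidableEq S]

/-- Total rate out of `x`: the holding time in `x` is exponential with this rate. -/
def exitRate (q : S → S → ℝ≥0∞) (x : S) : ℝ≥0∞ := ∑' y, q x y

/-- Transition probabilities of the embedded jump chain. -/
def jumpProb (q : S → S → ℝ≥0∞) (x y : S) : ℝ≥0∞ := q x y / exitRate q x

/-- `tabooProb q x n y` is the probability that the jump chain, started in `x`, is in `y` after
`n` jumps and has not returned to `x` in jumps `1, …, n`. -/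
def tabooProb (q : S → S → ℝ≥0∞) (x : S) : ℕ → S → ℝ≥0∞
  | 0 => fun y => if y = x then 1 else 0
  | n + 1 => fun y => if y = x then 0 else ∑' z, tabooProb q x n z * jumpProb q z y

/-- Mean return time to `x` of the continuous-time chain started in `x`: the sum, over all jumps
`n` before the first return, of the mean holding time in the current state. For bounded exit
rates the value is infinite if the chain fails to return with positive probability. -/
def meanReturnTime (q : S → S → ℝ≥0∞) (x : S) : ℝ≥0∞ :=
  ∑' n, ∑' y, tabooProb q x n y * (exitRate q y)⁻¹

/-- A state is positive recurrent if its mean return time is finite. -/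
def PositiveRecurrent (q : S → S → ℝ≥0∞) (x : S) : Prop := meanReturnTime q x < ∞

/-- `y` can be reached from `x` through transitions of positive rate. -/
def Reachable (q : S → S → ℝ≥0∞) : S → S → Prop :=
  Relation.ReflTransGen fun x y => 0 < q x y

/-- `π` is a stationary probability distribution (global balance equations). -/
structure IsStationary (q : S → S → ℝ≥0∞) (π : S → ℝ≥0∞) : Prop where
  total : ∑' x, π x = 1
  balance : ∀ y, ∑' x, π x * q x y = π y * exitRate q y

end Chain

/-! ### Parallel FCFS queues with exponential service and immediate dispatching -/

/-- The servers: `kF` fast ones and `kS` slow ones. -/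
abbrev Server (kF kS : ℕ) : Type := Fin kF ⊕ Fin kS

/-- A state records the number of jobs at each server, the one in service included. -/
abbrev QState (kF kS : ℕ) : Type := Server kF kS → ℕ

/-- The empty system. -/
def emptyState (kF kS : ℕ) : QState kF kS := fun _ => 0

/-- Service rate of a server. -/
def serviceRate {kF kS : ℕ} (μF μS : ℝ) : Server kF kS → ℝ :=
  Sum.elim (fun _ => μF) (fun _ => μS)

/-- A dispatching rule based on the current queue lengths: `D x s` is the probability that a job
arriving in state `x` is sent to server `s`. -/
structure IsDispatchRule {kF kS : ℕ} (D : QState kF kS → Server kF kS → ℝ) : Prop where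
  nonneg : ∀ x s, 0 ≤ D x s
  total : ∀ x, ∑ s, D x s = 1

/-- Transition rates of the queue lengths: jobs arrive at rate `lam * (kF + kS)` and join server
`s` with probability `D x s`; a busy server completes jobs at its service rate. -/
def queueRate {kF kS : ℕ} (lam μF μS : ℝ) (D : QState kF kS → Server kF kS → ℝ)
    (x y : QState kF kS) : ℝ≥0∞ :=
  ∑ s : Server kF kS,
    ((if y = Function.update x s (x s + 1) then
        ENNReal.ofReal (lam * ((kF : ℝ) + kS) * D x s) else 0) +
      (if 0 < x s ∧ y = Function.update x s (x s - 1) then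
        ENNReal.ofReal (serviceRate μF μS s) else 0))

/-- The system is stable if its queue-length process is positive recurrent on the set of states
that it can reach from the empty system. (The empty state can be reached from every state, so
these states form a single communicating class.) -/
def IsStable {kF kS : ℕ} (q : QState kF kS → QState kF kS → ℝ≥0∞) : Prop :=
  ∀ x, Chain.Reachable q (emptyState kF kS) x → Chain.PositiveRecurrent q x

/-! ### The two families of policies -/

/-- The two families. -/
inductive Policy : Type
  | JIQ
  | JSQ

/-- Uniform distribution on a finite set `C`. -/
def unifOn {α : Type} [DecidableEq α] (C : Finset α) (a : α) : ℝ :=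
  if a ∈ C then 1 / (C.card : ℝ) else 0

/-- Among the queried servers `A` of one class, all of them busy and with queue lengths `n`, the
ones between which the job is dispatched uniformly at random: all of `A` under JIQ, the ones with
the shortest queue under JSQ. -/
def candidates {α : Type} [DecidableEq α] (pol : Policy) (n : α → ℕ) (A : Finset α) : Finset α :=
  match pol with
  | Policy.JIQ => A
  | Policy.JSQ => A.filter fun i => ∀ j ∈ A, n i ≤ n j

/-- The idle servers among the queried ones. -/
def idleIn {α : Type} [DecidableEq α] (n : α → ℕ) (A : Finset α) : Finset α :=
  A.filter fun i => n i = 0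

/-- Dispatching probabilities in state `x`, given the set `A` of queried fast servers and the set
`B` of queried slow servers. -/
def dispatchGiven {kF kS : ℕ} (pol : Policy) (pF pS : ℝ) (x : QState kF kS)
    (A : Finset (Fin kF)) (B : Finset (Fin kS)) : Server kF kS → ℝ :=
  let nF : Fin kF → ℕ := fun i => x (Sum.inl i)
  let nS : Fin kS → ℕ := fun j => x (Sum.inr j)
  if (idleIn nF A).Nonempty then
    Sum.elim (fun i => unifOn (idleIn nF A) i) (fun _ => 0)
  else if (idleIn nS B).Nonempty then
    Sum.elim (fun i => (1 - pS) * unifOn (candidates pol nF A) i)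
      (fun j => pS * unifOn (idleIn nS B) j)
  else
    Sum.elim (fun i => pF * unifOn (candidates pol nF A) i)
      (fun j => (1 - pF) * unifOn (candidates pol nS B) j)

/-- Dispatching probabilities of JIQ-`(dF, dS)` and JSQ-`(dF, dS)`: `dF` fast servers and `dS` slow
servers are queried, uniformly at random without replacement. -/
def dispatch {kF kS : ℕ} (pol : Policy) (dF dS : ℕ) (pF pS : ℝ)
    (x : QState kF kS) (s : Server kF kS) : ℝ :=
  (∑ A ∈ (Finset.univ : Finset (Fin kF)).powersetCard dF,
    ∑ B ∈ (Finset.univ : Finset (Fin kS)).powersetCard dS,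
      dispatchGiven pol pF pS x A B s) / ((kF.choose dF : ℝ) * (kS.choose dS : ℝ))

/-- Transition rates of the queue lengths under a policy of one of the two families. -/
def policyRate {kF kS : ℕ} (lam μF μS : ℝ) (pol : Policy) (dF dS : ℕ) (pF pS : ℝ) :
    QState kF kS → QState kF kS → ℝ≥0∞ :=
  queueRate lam μF μS (dispatch pol dF dS pF pS)

/-! ### Mean response time and optimal parameters -/

/-- Stationary mean response time: by Little's law, the mean number of jobs in the system under
the stationary distribution divided by the arrival rate `lam * (kF + kS)`. There is at most one
stationary distribution; if there is none, the value is infinite. -/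
def meanResponseTime {kF kS : ℕ} (lam : ℝ) (q : QState kF kS → QState kF kS → ℝ≥0∞) : ℝ≥0∞ :=
  ⨅ (π : QState kF kS → ℝ≥0∞) (_ : Chain.IsStationary q π),
    (∑' x, π x * ((∑ s, x s : ℕ) : ℝ≥0∞)) / ENNReal.ofReal (lam * ((kF : ℝ) + kS))

/-- `(pF, pS)` minimizes the mean response time over `[0, 1] × [0, 1]`. -/
def IsOptimal (kF kS : ℕ) (lam μF μS : ℝ) (pol : Policy) (dF dS : ℕ) (pF pS : ℝ) : Prop :=
  pF ∈ Set.Icc (0 : ℝ) 1 ∧ pS ∈ Set.Icc (0 : ℝ) 1 ∧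
    ∀ pF' ∈ Set.Icc (0 : ℝ) 1, ∀ pS' ∈ Set.Icc (0 : ℝ) 1,
      meanResponseTime lam (policyRate (kF := kF) (kS := kS) lam μF μS pol dF dS pF pS) ≤
        meanResponseTime lam (policyRate (kF := kF) (kS := kS) lam μF μS pol dF dS pF' pS')

end

open Filter Topology

namespace Chain

section Recurrence

variable {S : Type} {q : S → S → ℝ≥0∞}

theorem mul_exitRate_mul_jumpProb (h0 : ∀ x, exitRate q x ≠ 0) (hT : ∀ x, exitRate q x ≠ ∞)
    (a : ℝ≥0∞) (x y : S) : a * exitRate q x * jumpProb q x y = a * q x y := by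
  rw [jumpProb, mul_assoc, ENNReal.mul_div_cancel (h0 x) (hT x)]

theorem tsum_jumpProb (h0 : ∀ x, exitRate q x ≠ 0) (hT : ∀ x, exitRate q x ≠ ∞) (x : S) :
    ∑' y, jumpProb q x y = 1 := by
  simp only [jumpProb, div_eq_mul_inv]
  rw [ENNReal.tsum_mul_right]
  exact ENNReal.mul_inv_cancel (h0 x) (hT x)

theorem IsStationary.ne_zero_of_rate {π : S → ℝ≥0∞} (h : IsStationary q π) {x y : S}
    (hx : π x ≠ 0) (hxy : 0 < q x y) : π y ≠ 0 := by
  intro hy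
  have hb := h.balance y
  rw [hy, zero_mul, ENNReal.tsum_eq_zero] at hb
  exact (mul_ne_zero hx hxy.ne') (hb x)

theorem IsStationary.ne_zero_of_reachable {π : S → ℝ≥0∞} (h : IsStationary q π) {x y : S}
    (hx : π x ≠ 0) (hxy : Reachable q x y) : π y ≠ 0 := by
  induction hxy with
  | refl => exact hx
  | tail _ hr ih => exact h.ne_zero_of_rate ih hr

variable [DecidableEq S]

theorem tabooProb_succ_of_ne {x y : S} (h : y ≠ x) (n : ℕ) :
    tabooProb q x (n + 1) y = ∑' z, tabooProb q x n z * jumpProb q z y := by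
  simp [tabooProb, h]

/-- An invariant measure dominates the multiple of the excursion measure with the same mass at
the starting point. -/
theorem IsStationary.mul_sum_tabooProb_le {π : S → ℝ≥0∞} (h : IsStationary q π)
    (h0 : ∀ x, exitRate q x ≠ 0) (hT : ∀ x, exitRate q x ≠ ∞) (x : S) (n : ℕ) (y : S) :
    ∑ i ∈ Finset.range n, π x * exitRate q x * tabooProb q x i y ≤ π y * exitRate q y := by
  induction n generalizing y with
  | zero => simp
  | succ n ih =>
    rw [Finset.sum_range_succ']
    by_cases hy : y = x
    · subst hy
      simp [tabooProb]
    · have e0 : tabooProb q x 0 y = 0 := by simp [tabooProb, hy]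
      rw [e0, mul_zero, add_zero, ← h.balance y]
      calc ∑ i ∈ Finset.range n, π x * exitRate q x * tabooProb q x (i + 1) y
          = ∑' z, (∑ i ∈ Finset.range n, π x * exitRate q x * tabooProb q x i z) *
              jumpProb q z y := by
            simp_rw [tabooProb_succ_of_ne hy, ← ENNReal.tsum_mul_left, Finset.sum_mul]
            rw [Summable.tsum_finsetSum fun _ _ => ENNReal.summable]
            simp_rw [mul_assoc]
        _ ≤ ∑' z, π z * exitRate q z * jumpProb q z y :=
            ENNReal.tsum_le_tsum fun z => mul_le_mul_left (ih z) _
        _ = ∑' z, π z * q z y := by simp_rw [mul_exitRate_mul_jumpProb h0 hT]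

/-- A state that carries mass under a stationary distribution is positive recurrent. -/
theorem IsStationary.positiveRecurrent {π : S → ℝ≥0∞} (h : IsStationary q π)
    (h0 : ∀ x, exitRate q x ≠ 0) (hT : ∀ x, exitRate q x ≠ ∞) {x : S} (hx : π x ≠ 0) :
    PositiveRecurrent q x := by
  have key : π x * exitRate q x * meanReturnTime q x ≤ 1 := by
    calc π x * exitRate q x * meanReturnTime q x
        = ∑' y, (∑' n, π x * exitRate q x * tabooProb q x n y) * (exitRate q y)⁻¹ := by
          rw [meanReturnTime, ENNReal.tsum_comm, ← ENNReal.tsum_mul_left]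
          refine tsum_congr fun y => ?_
          rw [ENNReal.tsum_mul_right, ENNReal.tsum_mul_left]
          simp only [mul_assoc]
      _ ≤ ∑' y, π y * exitRate q y * (exitRate q y)⁻¹ := by
          refine ENNReal.tsum_le_tsum fun y => mul_le_mul_left ?_ _
          exact ENNReal.tsum_le_of_sum_range_le fun n => h.mul_sum_tabooProb_le h0 hT x n y
      _ = 1 := by
          rw [← h.total]
          refine tsum_congr fun y => ?_
          rw [mul_assoc, ENNReal.mul_inv_cancel (h0 y) (hT y), mul_one]
  rw [PositiveRecurrent, lt_top_iff_ne_top]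
  intro htop
  rw [htop, ENNReal.mul_top (mul_ne_zero hx (h0 x))] at key
  exact absurd key (by simp)

/-- A positive recurrent chain with bounded exit rates returns with probability one. -/
theorem tsum_return_eq_one {Λ : ℝ≥0∞} (hΛ : Λ ≠ ∞) (hb : ∀ x, exitRate q x ≤ Λ)
    (h0 : ∀ x, exitRate q x ≠ 0) {x : S} (hx : PositiveRecurrent q x) :
    ∑' n, ∑' z, tabooProb q x n z * jumpProb q z x = 1 := by
  have hT : ∀ x, exitRate q x ≠ ∞ := fun x => ne_top_of_le_ne_top hΛ (hb x)
  have hfin : ∑' n, ∑' y, tabooProb q x n y ≠ ∞ := by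
    refine ne_top_of_le_ne_top (ENNReal.mul_ne_top hΛ (ne_of_lt hx)) ?_
    rw [meanReturnTime, ← ENNReal.tsum_mul_left]
    refine ENNReal.tsum_le_tsum fun n => ?_
    rw [← ENNReal.tsum_mul_left]
    refine ENNReal.tsum_le_tsum fun y => ?_
    calc tabooProb q x n y = exitRate q y * (exitRate q y)⁻¹ * tabooProb q x n y := by
          rw [ENNReal.mul_inv_cancel (h0 y) (hT y), one_mul]
      _ ≤ Λ * (exitRate q y)⁻¹ * tabooProb q x n y := by gcongr; exact hb y
      _ = Λ * (tabooProb q x n y * (exitRate q y)⁻¹) := by ring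
  have hstep : ∀ n, ∑' y, tabooProb q x (n + 1) y +
      ∑' z, tabooProb q x n z * jumpProb q z x = ∑' y, tabooProb q x n y := by
    intro n
    have e1 : ∑' z, tabooProb q x n z * jumpProb q z x =
        ∑' y, if y = x then ∑' z, tabooProb q x n z * jumpProb q z y else 0 := by
      rw [tsum_ite_eq]
    rw [e1, ← ENNReal.tsum_add]
    calc ∑' y, (tabooProb q x (n + 1) y +
          if y = x then ∑' z, tabooProb q x n z * jumpProb q z y else 0)
        = ∑' y, ∑' z, tabooProb q x n z * jumpProb q z y := by
          refine tsum_congr fun y => ?_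
          by_cases hy : y = x <;> simp [tabooProb, hy]
      _ = ∑' z, tabooProb q x n z := by
          rw [ENNReal.tsum_comm]
          refine tsum_congr fun z => ?_
          rw [ENNReal.tsum_mul_left, tsum_jumpProb h0 hT, mul_one]
  have hsum : ∑' n, ∑' y, tabooProb q x (n + 1) y +
      ∑' n, ∑' z, tabooProb q x n z * jumpProb q z x =
      ∑' n, ∑' y, tabooProb q x (n + 1) y + 1 := by
    rw [← ENNReal.tsum_add]
    simp_rw [hstep]
    rw [tsum_eq_zero_add' ENNReal.summable, add_comm]
    congr 1
    simp [tabooProb]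
  have hfin' : ∑' n, ∑' y, tabooProb q x (n + 1) y ≠ ∞ := by
    refine ne_top_of_le_ne_top hfin ?_
    rw [tsum_eq_zero_add' (f := fun n => ∑' y, tabooProb q x n y) ENNReal.summable]
    exact le_add_self
  exact (ENNReal.add_right_inj hfin').1 hsum

/-- A positive recurrent state of a chain with bounded exit rates carries mass under some
stationary distribution. -/
theorem exists_isStationary_of_positiveRecurrent {Λ : ℝ≥0∞} (hΛ : Λ ≠ ∞)
    (hb : ∀ x, exitRate q x ≤ Λ) (h0 : ∀ x, exitRate q x ≠ 0) {x : S}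
    (hx : PositiveRecurrent q x) : ∃ π, IsStationary q π ∧ π x ≠ 0 := by
  have hT : ∀ x, exitRate q x ≠ ∞ := fun x => ne_top_of_le_ne_top hΛ (hb x)
  set G : S → ℝ≥0∞ := fun y => ∑' n, tabooProb q x n y with hG
  have hGx : G x = 1 := by
    simp only [hG]
    rw [tsum_eq_zero_add' ENNReal.summable]
    simp [tabooProb]
  have hinv : ∀ y, ∑' z, G z * jumpProb q z y = G y := by
    intro y
    have e : ∑' z, G z * jumpProb q z y = ∑' n, ∑' z, tabooProb q x n z * jumpProb q z y := by
      rw [ENNReal.tsum_comm]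
      exact tsum_congr fun z => ENNReal.tsum_mul_right.symm
    rw [e]
    by_cases hy : y = x
    · subst hy
      rw [hGx, tsum_return_eq_one hΛ hb h0 hx]
    · simp_rw [← tabooProb_succ_of_ne hy]
      simp only [hG]
      rw [tsum_eq_zero_add' (f := fun n => tabooProb q x n y) ENNReal.summable]
      simp [tabooProb, hy]
  have hM : ∑' y, G y * (exitRate q y)⁻¹ = meanReturnTime q x := by
    rw [meanReturnTime, ENNReal.tsum_comm]
    exact tsum_congr fun y => ENNReal.tsum_mul_right.symm
  set M := meanReturnTime q x with hMdef
  have hMT : M ≠ ∞ := ne_of_lt hx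
  have hgx : G x * (exitRate q x)⁻¹ ≠ 0 := by
    rw [hGx, one_mul]; exact ENNReal.inv_ne_zero.2 (hT x)
  have hM0 : M ≠ 0 := by
    rw [← hM]
    intro h
    exact hgx (ENNReal.tsum_eq_zero.1 h x)
  have hbal : ∀ z, ∀ y, G z * (exitRate q z)⁻¹ * M⁻¹ * q z y = M⁻¹ * (G z * jumpProb q z y) := by
    intro z y
    rw [jumpProb, div_eq_mul_inv]; ring
  refine ⟨fun y => G y * (exitRate q y)⁻¹ * M⁻¹, ⟨?_, fun y => ?_⟩, ?_⟩
  · rw [ENNReal.tsum_mul_right, hM, ENNReal.mul_inv_cancel hM0 hMT]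
  · simp_rw [hbal]
    rw [ENNReal.tsum_mul_left, hinv]
    calc M⁻¹ * G y = M⁻¹ * G y * ((exitRate q y)⁻¹ * exitRate q y) := by
          rw [ENNReal.inv_mul_cancel (h0 y) (hT y), mul_one]
      _ = _ := by ring
  · exact mul_ne_zero hgx (ENNReal.inv_ne_zero.2 hMT)

end Recurrence

section Limits

variable {S : Type}

theorem exists_ultrafilter_limit {ι : Type*} (U : Ultrafilter ι) (f : ι → S → ℝ≥0∞) :
    ∃ g : S → ℝ≥0∞, ∀ x, Tendsto (fun i => f i x) U (𝓝 (g x)) :=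
  ⟨fun x => (U.map fun i => f i x).lim, fun x => (U.map fun i => f i x).le_nhds_lim⟩

theorem tsum_mul_le_of_tendsto {ι : Type*} {l : Filter ι} [l.NeBot] {f : ι → S → ℝ≥0∞}
    {g : S → ℝ≥0∞} (hfg : ∀ x, Tendsto (fun i => f i x) l (𝓝 (g x))) {W : S → ℝ≥0∞}
    (hW : ∀ x, W x ≠ ∞) {C : ℝ≥0∞} (hC : ∀ᶠ i in l, ∑' x, f i x * W x ≤ C) :
    ∑' x, g x * W x ≤ C := by
  refine ENNReal.summable.tsum_le_of_sum_le fun F => ?_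
  have ht : Tendsto (fun i => ∑ x ∈ F, f i x * W x) l (𝓝 (∑ x ∈ F, g x * W x)) :=
    tendsto_finsetSum _ fun x _ => ENNReal.Tendsto.mul_const (hfg x) (Or.inr (hW x))
  refine le_of_tendsto ht ?_
  filter_upwards [hC] with i hi
  exact (ENNReal.sum_le_tsum F).trans hi

/-- Tight pointwise limits of probability distributions are probability distributions. -/
theorem tsum_eq_one_of_tendsto {ι : Type*} {l : Filter ι} [l.NeBot] {f : ι → S → ℝ≥0∞}
    {g : S → ℝ≥0∞} (hfg : ∀ x, Tendsto (fun i => f i x) l (𝓝 (g x)))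
    (hf : ∀ᶠ i in l, ∑' x, f i x = 1) {W : S → ℝ≥0∞}
    (hWf : ∀ n : ℕ, {x | W x ≤ n}.Finite) {C : ℝ≥0∞} (hCT : C ≠ ∞)
    (hC : ∀ᶠ i in l, ∑' x, f i x * W x ≤ C) : ∑' x, g x = 1 := by
  apply le_antisymm
  · have := tsum_mul_le_of_tendsto hfg (W := fun _ => 1) (by simp) (C := 1)
      (hf.mono fun i hi => by simp [hi])
    simpa using this
  · have key : ∀ n : ℕ, (n : ℝ≥0∞) ≤ n * (∑' x, g x) + C := by
      intro n
      have h1 : ∀ᶠ i in l, (n : ℝ≥0∞) ≤ n * (∑ x ∈ (hWf n).toFinset, f i x) + C := by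
        filter_upwards [hf, hC] with i hi hi'
        calc (n : ℝ≥0∞) = ∑' x, n * f i x := by rw [ENNReal.tsum_mul_left, hi, mul_one]
          _ ≤ ∑' x, (n * ((hWf n).toFinset : Set S).indicator (f i) x + f i x * W x) := by
              refine ENNReal.tsum_le_tsum fun x => ?_
              by_cases hx : W x ≤ n
              · rw [Set.indicator_of_mem (by simpa using hx)]
                exact le_self_add
              · rw [mul_comm]
                exact le_add_left (mul_le_mul_right (not_le.1 hx).le _)
          _ = n * (∑ x ∈ (hWf n).toFinset, f i x) + ∑' x, f i x * W x := by
              rw [ENNReal.tsum_add, ENNReal.tsum_mul_left, sum_eq_tsum_indicator]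
          _ ≤ _ := by gcongr
      have ht : Tendsto (fun i => (n : ℝ≥0∞) * (∑ x ∈ (hWf n).toFinset, f i x) + C) l
          (𝓝 (n * (∑ x ∈ (hWf n).toFinset, g x) + C)) :=
        (ENNReal.Tendsto.const_mul (tendsto_finsetSum _ fun x _ => hfg x)
          (Or.inr (ENNReal.natCast_ne_top n))).add tendsto_const_nhds
      refine (ge_of_tendsto ht h1).trans ?_
      gcongr
      exact ENNReal.sum_le_tsum _
    set s := ∑' x, g x
    have key2 : ∀ n : ℕ, 1 ≤ s + C * ((n + 1 : ℕ) : ℝ≥0∞)⁻¹ := by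
      intro n
      have hn0 : ((n + 1 : ℕ) : ℝ≥0∞) ≠ 0 := by simp
      have hnT : ((n + 1 : ℕ) : ℝ≥0∞) ≠ ∞ := ENNReal.natCast_ne_top _
      have := mul_le_mul_left (key (n + 1)) (((n + 1 : ℕ) : ℝ≥0∞)⁻¹)
      rw [ENNReal.mul_inv_cancel hn0 hnT, add_mul, mul_right_comm,
        ENNReal.mul_inv_cancel hn0 hnT, one_mul] at this
      exact this
    have hlim : Tendsto (fun n : ℕ => s + C * ((n + 1 : ℕ) : ℝ≥0∞)⁻¹) atTop (𝓝 (s + C * 0)) :=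
      tendsto_const_nhds.add (ENNReal.Tendsto.const_mul
        ((tendsto_add_atTop_iff_nat 1).2 ENNReal.tendsto_inv_nat_nhds_zero) (Or.inr hCT))
    rw [mul_zero, add_zero] at hlim
    exact ge_of_tendsto' hlim key2

theorem tendsto_tsum_mul_of_finite_support {ι : Type*} {l : Filter ι} {f : ι → S → ℝ≥0∞}
    {g : S → ℝ≥0∞} (hfg : ∀ x, Tendsto (fun i => f i x) l (𝓝 (g x))) (hg : ∀ x, g x ≠ ∞)
    {r : ι → S → ℝ≥0∞} {r' : S → ℝ≥0∞} (hr : ∀ x, Tendsto (fun i => r i x) l (𝓝 (r' x)))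
    (hr' : ∀ x, r' x ≠ ∞) (F : Finset S) (hF : ∀ i, ∀ x ∉ F, r i x = 0)
    (hF' : ∀ x ∉ F, r' x = 0) :
    Tendsto (fun i => ∑' x, f i x * r i x) l (𝓝 (∑' x, g x * r' x)) := by
  have e : ∀ i, ∑' x, f i x * r i x = ∑ x ∈ F, f i x * r i x := fun i =>
    tsum_eq_sum fun x hx => by rw [hF i x hx, mul_zero]
  have e' : ∑' x, g x * r' x = ∑ x ∈ F, g x * r' x :=
    tsum_eq_sum fun x hx => by rw [hF' x hx, mul_zero]
  simp_rw [e, e']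
  exact tendsto_finsetSum _ fun x _ =>
    ENNReal.Tendsto.mul (hfg x) (Or.inr (hr' x)) (hr x) (Or.inr (hg x))

end Limits

end Chain

noncomputable section

namespace Chain

section Uniformisation

variable {S : Type} {q : S → S → ℝ≥0∞} {Λ : ℝ≥0∞}

theorem le_one_of_tsum_eq_one {π : S → ℝ≥0∞} (h : ∑' x, π x = 1) (x : S) : π x ≤ 1 :=
  h ▸ ENNReal.le_tsum x

theorem exitRate_div_add_sub (hΛ0 : Λ ≠ 0) (hΛ : Λ ≠ ∞) (hb : ∀ x, exitRate q x ≤ Λ) (x : S) :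
    exitRate q x / Λ + (1 - exitRate q x / Λ) = 1 :=
  add_tsub_cancel_of_le <| (ENNReal.div_le_iff hΛ0 hΛ).2 (by rw [one_mul]; exact hb x)

variable [DecidableEq S]

/-- Transition probabilities of the chain uniformised at rate `Λ`. -/
def unifKernel (q : S → S → ℝ≥0∞) (Λ : ℝ≥0∞) (x y : S) : ℝ≥0∞ :=
  q x y / Λ + if y = x then 1 - exitRate q x / Λ else 0

/-- Distribution of the uniformised chain after `n` steps from `x₀`. -/
def unifDist (q : S → S → ℝ≥0∞) (Λ : ℝ≥0∞) (x₀ : S) : ℕ → S → ℝ≥0∞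
  | 0 => fun y => if y = x₀ then 1 else 0
  | n + 1 => fun y => ∑' x, unifDist q Λ x₀ n x * unifKernel q Λ x y

theorem tsum_unifKernel_mul (x : S) (f : S → ℝ≥0∞) :
    ∑' y, unifKernel q Λ x y * f y =
      (∑' y, q x y * f y) / Λ + (1 - exitRate q x / Λ) * f x := by
  have e : ∀ y, unifKernel q Λ x y * f y = q x y * f y * Λ⁻¹ +
      if y = x then (1 - exitRate q x / Λ) * f y else 0 := by
    intro y
    rw [unifKernel, add_mul, div_eq_mul_inv]
    congr 1
    · ring
    · split_ifs <;> simp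
  simp_rw [e]
  rw [ENNReal.tsum_add, tsum_ite_eq, ENNReal.tsum_mul_right]
  simp only [div_eq_mul_inv]

theorem tsum_mul_unifKernel (π : S → ℝ≥0∞) (y : S) :
    ∑' x, π x * unifKernel q Λ x y =
      (∑' x, π x * q x y) / Λ + π y * (1 - exitRate q y / Λ) := by
  have e : ∀ x, π x * unifKernel q Λ x y = π x * q x y * Λ⁻¹ +
      if x = y then π x * (1 - exitRate q x / Λ) else 0 := by
    intro x
    rw [unifKernel, mul_add, div_eq_mul_inv]
    congr 1
    · ring
    · by_cases h : x = y
      · subst h; simp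
      · simp [h, Ne.symm h]
  simp_rw [e]
  rw [ENNReal.tsum_add, tsum_ite_eq, ENNReal.tsum_mul_right]
  simp only [div_eq_mul_inv]

theorem tsum_unifKernel (hΛ0 : Λ ≠ 0) (hΛ : Λ ≠ ∞) (hb : ∀ x, exitRate q x ≤ Λ) (x : S) :
    ∑' y, unifKernel q Λ x y = 1 := by
  have := tsum_unifKernel_mul (q := q) (Λ := Λ) x fun _ => 1
  simp only [mul_one] at this
  rw [this]
  exact exitRate_div_add_sub hΛ0 hΛ hb x

theorem tsum_unifDist_succ_mul (x₀ : S) (n : ℕ) (f : S → ℝ≥0∞) :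
    ∑' y, unifDist q Λ x₀ (n + 1) y * f y =
      ∑' x, unifDist q Λ x₀ n x * ∑' y, unifKernel q Λ x y * f y := by
  simp only [unifDist, ← ENNReal.tsum_mul_right, ← ENNReal.tsum_mul_left]
  rw [ENNReal.tsum_comm]
  simp only [mul_assoc]

theorem tsum_unifDist (hΛ0 : Λ ≠ 0) (hΛ : Λ ≠ ∞) (hb : ∀ x, exitRate q x ≤ Λ) (x₀ : S) (n : ℕ) :
    ∑' y, unifDist q Λ x₀ n y = 1 := by
  induction n with
  | zero => simp [unifDist]
  | succ n ih =>
    have := tsum_unifDist_succ_mul (q := q) (Λ := Λ) x₀ n fun _ => 1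
    simp only [mul_one, tsum_unifKernel hΛ0 hΛ hb, ih] at this
    exact this

theorem unifDist_drift_bound (hΛ0 : Λ ≠ 0) (hΛ : Λ ≠ ∞) (hb : ∀ x, exitRate q x ≤ Λ) (x₀ : S)
    {V W : S → ℝ≥0∞} {C : ℝ≥0∞}
    (hdrift : ∀ x, ∑' y, q x y * V y + W x ≤ exitRate q x * V x + C) (n : ℕ) :
    ∑' x, unifDist q Λ x₀ n x * V x +
      ∑ i ∈ Finset.range n, ∑' x, unifDist q Λ x₀ i x * (W x / Λ) ≤ V x₀ + n * (C / Λ) := by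
  have hstep : ∀ x, ∑' y, unifKernel q Λ x y * V y + W x / Λ ≤ V x + C / Λ := by
    intro x
    rw [tsum_unifKernel_mul]
    calc (∑' y, q x y * V y) / Λ + (1 - exitRate q x / Λ) * V x + W x / Λ
        = (∑' y, q x y * V y + W x) / Λ + (1 - exitRate q x / Λ) * V x := by
          rw [ENNReal.add_div]; ring
      _ ≤ (exitRate q x * V x + C) / Λ + (1 - exitRate q x / Λ) * V x := by
          exact add_le_add_left (ENNReal.div_le_div_right (hdrift x) _) _
      _ = (exitRate q x / Λ + (1 - exitRate q x / Λ)) * V x + C / Λ := by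
          rw [ENNReal.add_div]; simp only [div_eq_mul_inv]; ring
      _ = V x + C / Λ := by rw [exitRate_div_add_sub hΛ0 hΛ hb, one_mul]
  induction n with
  | zero => simp [unifDist, ite_mul]
  | succ n ih =>
    rw [Finset.sum_range_succ, tsum_unifDist_succ_mul]
    calc ∑' x, unifDist q Λ x₀ n x * ∑' y, unifKernel q Λ x y * V y +
          (∑ i ∈ Finset.range n, ∑' x, unifDist q Λ x₀ i x * (W x / Λ) +
            ∑' x, unifDist q Λ x₀ n x * (W x / Λ))
        = ∑' x, unifDist q Λ x₀ n x * (∑' y, unifKernel q Λ x y * V y + W x / Λ) +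
          ∑ i ∈ Finset.range n, ∑' x, unifDist q Λ x₀ i x * (W x / Λ) := by
          simp_rw [mul_add]
          rw [ENNReal.tsum_add]; ring
      _ ≤ ∑' x, unifDist q Λ x₀ n x * (V x + C / Λ) +
          ∑ i ∈ Finset.range n, ∑' x, unifDist q Λ x₀ i x * (W x / Λ) := by
          exact add_le_add_left (ENNReal.tsum_le_tsum fun x => mul_le_mul_right (hstep x) _) _
      _ = ∑' x, unifDist q Λ x₀ n x * V x +
          ∑ i ∈ Finset.range n, ∑' x, unifDist q Λ x₀ i x * (W x / Λ) + C / Λ := by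
          simp_rw [mul_add]
          rw [ENNReal.tsum_add, ENNReal.tsum_mul_right, tsum_unifDist hΛ0 hΛ hb]; ring
      _ ≤ V x₀ + n * (C / Λ) + C / Λ := by gcongr
      _ = V x₀ + ((n + 1 : ℕ) : ℝ≥0∞) * (C / Λ) := by push_cast; ring

/-- Cesàro means of the distributions of the uniformised chain. -/
def cesaroDist (q : S → S → ℝ≥0∞) (Λ : ℝ≥0∞) (x₀ : S) (n : ℕ) (y : S) : ℝ≥0∞ :=
  ((n + 1 : ℕ) : ℝ≥0∞)⁻¹ * ∑ i ∈ Finset.range (n + 1), unifDist q Λ x₀ i y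

theorem tsum_cesaroDist_mul (x₀ : S) (n : ℕ) (f : S → ℝ≥0∞) :
    ∑' y, cesaroDist q Λ x₀ n y * f y =
      ((n + 1 : ℕ) : ℝ≥0∞)⁻¹ *
        ∑ i ∈ Finset.range (n + 1), ∑' y, unifDist q Λ x₀ i y * f y := by
  simp only [cesaroDist]
  rw [← Summable.tsum_finsetSum fun _ _ => ENNReal.summable, ← ENNReal.tsum_mul_left]
  simp only [mul_assoc, Finset.sum_mul]

theorem tsum_cesaroDist (hΛ0 : Λ ≠ 0) (hΛ : Λ ≠ ∞) (hb : ∀ x, exitRate q x ≤ Λ) (x₀ : S)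
    (n : ℕ) : ∑' y, cesaroDist q Λ x₀ n y = 1 := by
  have := tsum_cesaroDist_mul (q := q) (Λ := Λ) x₀ n fun _ => 1
  simp only [mul_one, tsum_unifDist hΛ0 hΛ hb, Finset.sum_const, Finset.card_range,
    nsmul_eq_mul] at this
  rw [this]
  exact ENNReal.inv_mul_cancel (by simp) (ENNReal.natCast_ne_top _)

theorem cesaroDist_almost_invariant (x₀ : S) (n : ℕ) (y : S) :
    ∑' x, cesaroDist q Λ x₀ n x * unifKernel q Λ x y +
        ((n + 1 : ℕ) : ℝ≥0∞)⁻¹ * unifDist q Λ x₀ 0 y =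
      cesaroDist q Λ x₀ n y + ((n + 1 : ℕ) : ℝ≥0∞)⁻¹ * unifDist q Λ x₀ (n + 1) y := by
  rw [tsum_cesaroDist_mul x₀ n fun x => unifKernel q Λ x y, cesaroDist, ← mul_add, ← mul_add,
    ← Finset.sum_range_succ,
    Finset.sum_range_succ' _ (n + 1)]
  rfl

theorem tsum_cesaroDist_mul_le (hΛ0 : Λ ≠ 0) (hΛ : Λ ≠ ∞) (hb : ∀ x, exitRate q x ≤ Λ) (x₀ : S)
    {V W : S → ℝ≥0∞} {C : ℝ≥0∞}
    (hdrift : ∀ x, ∑' y, q x y * V y + W x ≤ exitRate q x * V x + C) (n : ℕ) :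
    ∑' x, cesaroDist q Λ x₀ n x * W x ≤ Λ * V x₀ + C := by
  have h := le_of_add_le_right (unifDist_drift_bound hΛ0 hΛ hb x₀ hdrift (n + 1))
  have hn0 : ((n + 1 : ℕ) : ℝ≥0∞) ≠ 0 := by simp
  have hnT : ((n + 1 : ℕ) : ℝ≥0∞) ≠ ∞ := ENNReal.natCast_ne_top _
  have e : ∀ x, W x = Λ * (W x / Λ) := fun x => (ENNReal.mul_div_cancel hΛ0 hΛ).symm
  calc ∑' x, cesaroDist q Λ x₀ n x * W x
      = Λ * (((n + 1 : ℕ) : ℝ≥0∞)⁻¹ *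
          ∑ i ∈ Finset.range (n + 1), ∑' x, unifDist q Λ x₀ i x * (W x / Λ)) := by
        rw [← tsum_cesaroDist_mul x₀ n fun x => W x / Λ, ← ENNReal.tsum_mul_left]
        refine tsum_congr fun x => ?_
        conv_lhs => rw [e x]
        ring
    _ ≤ Λ * (((n + 1 : ℕ) : ℝ≥0∞)⁻¹ * (V x₀ + ((n + 1 : ℕ) : ℝ≥0∞) * (C / Λ))) := by gcongr
    _ = ((n + 1 : ℕ) : ℝ≥0∞)⁻¹ * (Λ * V x₀) +
        (((n + 1 : ℕ) : ℝ≥0∞)⁻¹ * ((n + 1 : ℕ) : ℝ≥0∞)) * (Λ * (C / Λ)) := by ring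
    _ = ((n + 1 : ℕ) : ℝ≥0∞)⁻¹ * (Λ * V x₀) + C := by
        rw [ENNReal.inv_mul_cancel hn0 hnT, one_mul, ENNReal.mul_div_cancel hΛ0 hΛ]
    _ ≤ 1 * (Λ * V x₀) + C := by
        gcongr
        rw [ENNReal.inv_le_one]
        exact_mod_cast Nat.le_add_left 1 n
    _ = Λ * V x₀ + C := by rw [one_mul]

theorem hyperfilter_tendsto_inv_nat_succ :
    Tendsto (fun n : ℕ => ((n + 1 : ℕ) : ℝ≥0∞)⁻¹) (hyperfilter ℕ : Filter ℕ) (𝓝 0) :=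
  ((tendsto_add_atTop_iff_nat 1).2 ENNReal.tendsto_inv_nat_nhds_zero).mono_left
    (by rw [← Nat.cofinite_eq_atTop]; exact hyperfilter_le_cofinite)

/-- Foster's criterion, with a moment bound for the stationary distribution. -/
theorem exists_isStationary_of_drift (hΛ0 : Λ ≠ 0) (hΛ : Λ ≠ ∞) (hb : ∀ x, exitRate q x ≤ Λ)
    (hcol : ∀ y, {x | q x y ≠ 0}.Finite) (x₀ : S) {V W : S → ℝ≥0∞} {C : ℝ≥0∞}
    (hV : V x₀ ≠ ∞) (hW : ∀ x, W x ≠ ∞) (hWf : ∀ n : ℕ, {x | W x ≤ n}.Finite) (hC : C ≠ ∞)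
    (hdrift : ∀ x, ∑' y, q x y * V y + W x ≤ exitRate q x * V x + C) :
    ∃ π, IsStationary q π ∧ ∑' x, π x * W x ≠ ∞ := by
  obtain ⟨π, hπ⟩ := exists_ultrafilter_limit (hyperfilter ℕ) (cesaroDist q Λ x₀)
  have hB : Λ * V x₀ + C ≠ ∞ := ENNReal.add_ne_top.2 ⟨ENNReal.mul_ne_top hΛ hV, hC⟩
  have hle := fun n => tsum_cesaroDist_mul_le hΛ0 hΛ hb x₀ hdrift n
  have htot : ∑' x, π x = 1 := tsum_eq_one_of_tendsto hπ
    (Eventually.of_forall (tsum_cesaroDist hΛ0 hΛ hb x₀)) hWf hB (Eventually.of_forall hle)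
  have hπT : ∀ x, π x ≠ ∞ := fun x => ne_top_of_le_ne_top (by simp) (le_one_of_tsum_eq_one htot x)
  have hinv : ∀ y, ∑' x, π x * unifKernel q Λ x y = π y := by
    intro y
    have hKT : ∀ x, unifKernel q Λ x y ≠ ∞ := fun x =>
      ne_top_of_le_ne_top (by simp) (le_one_of_tsum_eq_one (tsum_unifKernel hΛ0 hΛ hb x) y)
    have hK0 : ∀ x ∉ insert y (hcol y).toFinset, unifKernel q Λ x y = 0 := by
      intro x hx
      simp only [Finset.mem_insert, Set.Finite.mem_toFinset, Set.mem_ofPred_eq, not_or,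
        not_not] at hx
      simp [unifKernel, hx.2, Ne.symm hx.1]
    have t1 := tendsto_tsum_mul_of_finite_support hπ hπT
      (r := fun _ x => unifKernel q Λ x y) (fun _ => tendsto_const_nhds) hKT _ (fun _ => hK0) hK0
    have small : ∀ v : ℕ → ℝ≥0∞, (∀ n, v n ≤ 1) →
        Tendsto (fun n : ℕ => ((n + 1 : ℕ) : ℝ≥0∞)⁻¹ * v n) (hyperfilter ℕ : Filter ℕ)
          (𝓝 0) := fun v hv =>
      tendsto_of_tendsto_of_tendsto_of_le_of_le tendsto_const_nhds
        hyperfilter_tendsto_inv_nat_succ (fun _ => zero_le) fun n =>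
          (mul_le_mul_right (hv n) _).trans (mul_one _).le
    have hu : ∀ n, unifDist q Λ x₀ n y ≤ 1 := fun n =>
      le_one_of_tsum_eq_one (tsum_unifDist hΛ0 hΛ hb x₀ n) y
    have t2 := t1.add (small _ fun _ => hu 0)
    have t3 := (hπ y).add (small (fun n => unifDist q Λ x₀ (n + 1) y) fun n => hu (n + 1))
    simp_rw [cesaroDist_almost_invariant] at t2
    simpa using tendsto_nhds_unique t2 t3
  refine ⟨π, ⟨htot, fun y => ?_⟩,
    ne_top_of_le_ne_top hB (tsum_mul_le_of_tendsto hπ hW (Eventually.of_forall hle))⟩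
  have h := hinv y
  rw [tsum_mul_unifKernel] at h
  have h2 : (∑' x, π x * q x y) / Λ + π y * (1 - exitRate q y / Λ) =
      π y * exitRate q y / Λ + π y * (1 - exitRate q y / Λ) := by
    rw [h, mul_div_assoc, ← mul_add, exitRate_div_add_sub hΛ0 hΛ hb, mul_one]
  have h3 := (ENNReal.add_left_inj (ENNReal.mul_ne_top (hπT y)
    (ne_top_of_le_ne_top ENNReal.one_ne_top tsub_le_self))).1 h2
  have h4 := congrArg (Λ * ·) h3
  simpa only [ENNReal.mul_div_cancel hΛ0 hΛ] using h4

end Uniformisation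

section Optimisation

variable {S : Type} {P : Type*} [TopologicalSpace P]

/-- Over a compact set of parameters, the stationary mean of a function with finite sublevel sets
attains its infimum if that is finite. -/
theorem exists_minimal_stationary_mean {K : Set P} (hK : IsCompact K) {q : P → S → S → ℝ≥0∞}
    (hq : ∀ x y, Continuous fun p => q p x y) (hqT : ∀ p x y, q p x y ≠ ∞)
    (he : ∀ x, Continuous fun p => exitRate (q p) x) (heT : ∀ p x, exitRate (q p) x ≠ ∞)
    (hcol : ∀ y, ∃ F : Finset S, ∀ p, ∀ x ∉ F, q p x y = 0) {W : S → ℝ≥0∞}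
    (hW : ∀ x, W x ≠ ∞) (hWf : ∀ n : ℕ, {x | W x ≤ n}.Finite)
    (hex : ∃ p ∈ K, ∃ π, IsStationary (q p) π ∧ ∑' x, π x * W x ≠ ∞) :
    ∃ p ∈ K, ∃ π, IsStationary (q p) π ∧ ∑' x, π x * W x ≠ ∞ ∧
      ∀ p' ∈ K, ∀ π', IsStationary (q p') π' → ∑' x, π x * W x ≤ ∑' x, π' x * W x := by
  set T : Set ℝ≥0∞ := {c | ∃ p ∈ K, ∃ π, IsStationary (q p) π ∧ ∑' x, π x * W x = c} with hT
  obtain ⟨p₀, hp₀, π₀, hπ₀, hfin⟩ := hex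
  have hne : T.Nonempty := ⟨_, p₀, hp₀, π₀, hπ₀, rfl⟩
  have hmT : sInf T < ∞ := lt_of_le_of_lt (sInf_le ⟨p₀, hp₀, π₀, hπ₀, rfl⟩)
    (lt_top_iff_ne_top.2 hfin)
  obtain ⟨u, -, hu, huT⟩ := exists_seq_tendsto_sInf hne (OrderBot.bddBelow T)
  choose p hpK f hf hfu using huT
  have hcof : (hyperfilter ℕ : Filter ℕ) ≤ atTop := by
    rw [← Nat.cofinite_eq_atTop]; exact hyperfilter_le_cofinite
  obtain ⟨π, hπ⟩ := exists_ultrafilter_limit (hyperfilter ℕ) f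
  obtain ⟨p', hp'K, hp'⟩ := hK.ultrafilter_le_nhds ((hyperfilter ℕ).map p)
    (by
      rw [le_principal_iff]
      exact Eventually.of_forall (f := (hyperfilter ℕ : Filter ℕ)) hpK)
  have hp' : Tendsto p (hyperfilter ℕ : Filter ℕ) (𝓝 p') := hp'
  have hev : ∀ c, sInf T < c → ∀ᶠ n in (hyperfilter ℕ : Filter ℕ), ∑' x, f n x * W x ≤ c := by
    intro c hc
    filter_upwards [hcof (hu.eventually (gt_mem_nhds hc))] with n hn
    rw [hfu]; exact (le_of_lt hn)
  have hle : ∑' x, π x * W x ≤ sInf T :=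
    le_of_forall_gt_imp_ge_of_dense fun c hc => tsum_mul_le_of_tendsto hπ hW (hev c hc)
  obtain ⟨c, hc, hcT⟩ := exists_between hmT
  have htot : ∑' x, π x = 1 := tsum_eq_one_of_tendsto hπ
    (Eventually.of_forall fun n => (hf n).total) hWf hcT.ne (hev c hc)
  have hπT : ∀ x, π x ≠ ∞ := fun x => ne_top_of_le_ne_top (by simp) (le_one_of_tsum_eq_one htot x)
  refine ⟨p', hp'K, π, ⟨htot, fun y => ?_⟩, (hle.trans_lt hmT).ne, fun p'' hp'' π'' hπ'' =>
    hle.trans (sInf_le ⟨p'', hp'', π'', hπ'', rfl⟩)⟩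
  obtain ⟨F, hF⟩ := hcol y
  have t1 := tendsto_tsum_mul_of_finite_support hπ hπT (r := fun n x => q (p n) x y)
    (r' := fun x => q p' x y) (fun x => ((hq x y).tendsto p').comp hp') (fun x => hqT p' x y) F
    (fun n => hF (p n)) (hF p')
  have t2 : Tendsto (fun n => f n y * exitRate (q (p n)) y) (hyperfilter ℕ : Filter ℕ)
      (𝓝 (π y * exitRate (q p') y)) :=
    ENNReal.Tendsto.mul (hπ y) (Or.inr (heT p' y)) (((he y).tendsto p').comp hp')
      (Or.inr (hπT y))
  simp_rw [(hf _).balance] at t1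
  exact tendsto_nhds_unique t1 t2

end Optimisation

end Chain


section Dispatching

theorem unifOn_nonneg {α : Type} [DecidableEq α] (C : Finset α) (a : α) : 0 ≤ unifOn C a := by
  unfold unifOn; split_ifs <;> positivity

theorem unifOn_pos {α : Type} [DecidableEq α] {C : Finset α} {a : α} (h : a ∈ C) :
    0 < unifOn C a := by
  rw [unifOn, if_pos h]
  have : 0 < C.card := Finset.card_pos.2 ⟨a, h⟩
  positivity

theorem sum_unifOn_mul {α : Type} [DecidableEq α] [Fintype α] (C : Finset α) (f : α → ℝ) :
    ∑ a, unifOn C a * f a = (∑ a ∈ C, f a) / C.card := by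
  simp only [unifOn, ite_mul, zero_mul, Finset.sum_ite_mem, Finset.univ_inter]
  rw [Finset.sum_div]
  exact Finset.sum_congr rfl fun a _ => by ring

theorem sum_unifOn {α : Type} [DecidableEq α] [Fintype α] {C : Finset α} (h : C.Nonempty) :
    ∑ a, unifOn C a = 1 := by
  have := sum_unifOn_mul C fun _ => (1 : ℝ)
  have hc : (C.card : ℝ) ≠ 0 := by exact_mod_cast h.card_pos.ne'
  simpa [hc] using this

theorem mem_candidates_JSQ {α : Type} [DecidableEq α] {n : α → ℕ} {A : Finset α} {a : α} :
    a ∈ candidates Policy.JSQ n A ↔ a ∈ A ∧ ∀ j ∈ A, n a ≤ n j := by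
  simp [candidates]

theorem candidates_nonempty {α : Type} [DecidableEq α] (pol : Policy) (n : α → ℕ) {A : Finset α}
    (h : A.Nonempty) : (candidates pol n A).Nonempty := by
  cases pol with
  | JIQ => exact h
  | JSQ =>
    obtain ⟨i, hi, hmin⟩ := A.exists_min_image n h
    exact ⟨i, mem_candidates_JSQ.2 ⟨hi, hmin⟩⟩

theorem mem_candidates {α : Type} [DecidableEq α] (pol : Policy) {n : α → ℕ} {A : Finset α}
    {i : α} (hi : i ∈ A) (hmin : ∀ j, n i ≤ n j) : i ∈ candidates pol n A := by
  cases pol with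
  | JIQ => exact hi
  | JSQ => exact mem_candidates_JSQ.2 ⟨hi, fun j _ => hmin j⟩

theorem sum_unifOn_candidates_mul_le {α : Type} [DecidableEq α] [Fintype α] (pol : Policy)
    (n : α → ℕ) {A : Finset α} (h : A.Nonempty) :
    ∑ a, unifOn (candidates pol n A) a * (n a : ℝ) ≤ (∑ a ∈ A, (n a : ℝ)) / A.card := by
  have hA : (0 : ℝ) < A.card := by exact_mod_cast h.card_pos
  cases pol with
  | JIQ => exact (sum_unifOn_mul A _).le
  | JSQ =>
    have hC := candidates_nonempty Policy.JSQ n h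
    calc ∑ a, unifOn (candidates Policy.JSQ n A) a * (n a : ℝ)
        ≤ ∑ a, unifOn (candidates Policy.JSQ n A) a * ((∑ a ∈ A, (n a : ℝ)) / A.card) := by
          refine Finset.sum_le_sum fun a _ => ?_
          by_cases ha : a ∈ candidates Policy.JSQ n A
          · refine mul_le_mul_of_nonneg_left ?_ (unifOn_nonneg _ _)
            rw [le_div_iff₀ hA, mul_comm, ← nsmul_eq_mul]
            exact Finset.card_nsmul_le_sum _ _ _ fun j hj => by
              exact_mod_cast (mem_candidates_JSQ.1 ha).2 j hj
          · simp [unifOn, ha]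
      _ = _ := by rw [← Finset.sum_mul, sum_unifOn hC, one_mul]

theorem sum_unifOn_idleIn_mul {α : Type} [DecidableEq α] [Fintype α] (n : α → ℕ) (A : Finset α) :
    ∑ a, unifOn (idleIn n A) a * (n a : ℝ) = 0 := by
  rw [sum_unifOn_mul, Finset.sum_eq_zero, zero_div]
  intro a ha
  exact_mod_cast (Finset.mem_filter.1 ha).2

theorem idleIn_eq_empty {α : Type} [DecidableEq α] {n : α → ℕ} (h : ∀ i, 0 < n i)
    (A : Finset α) : ¬ (idleIn n A).Nonempty := by
  rintro ⟨i, hi⟩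
  exact (h i).ne' (Finset.mem_filter.1 hi).2

/-- Averaging the mean over a uniformly random `d`-subset gives the mean over the whole set. -/
theorem sum_powersetCard_mean {k d : ℕ} (hd : 1 ≤ d) (hdk : d ≤ k) (f : Fin k → ℝ) :
    ∑ A ∈ (Finset.univ : Finset (Fin k)).powersetCard d, (∑ i ∈ A, f i) / (A.card : ℝ) =
      (k.choose d : ℝ) * ((∑ i, f i) / k) := by
  have hcount : ∀ i : Fin k,
      (((Finset.univ : Finset (Fin k)).powersetCard d).filter (i ∈ ·)).card =
        (k - 1).choose (d - 1) := by
    intro i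
    have := Finset.card_filter_powersetCard_subset {i} (Finset.univ : Finset (Fin k)) d
      (Finset.subset_univ _) (by simpa using hd)
    simpa using this
  have hchoose : (k : ℝ) * ((k - 1).choose (d - 1) : ℝ) = (k.choose d : ℝ) * d := by
    have := Nat.add_one_mul_choose_eq (k - 1) (d - 1)
    rw [Nat.sub_add_cancel hd, Nat.sub_add_cancel (hd.trans hdk)] at this
    exact_mod_cast this
  have hsum : ∑ A ∈ (Finset.univ : Finset (Fin k)).powersetCard d, ∑ i ∈ A, f i =
      ((k - 1).choose (d - 1) : ℝ) * ∑ i, f i := by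
    calc ∑ A ∈ (Finset.univ : Finset (Fin k)).powersetCard d, ∑ i ∈ A, f i
        = ∑ A ∈ (Finset.univ : Finset (Fin k)).powersetCard d,
            ∑ i, if i ∈ A then f i else 0 := by simp
      _ = ∑ i, ((k - 1).choose (d - 1) : ℝ) * f i := by
          rw [Finset.sum_comm]
          refine Finset.sum_congr rfl fun i _ => ?_
          rw [← Finset.sum_filter, Finset.sum_const, hcount, nsmul_eq_mul]
      _ = _ := by rw [Finset.mul_sum]
  have hk : (k : ℝ) ≠ 0 := by exact_mod_cast Nat.one_le_iff_ne_zero.1 (hd.trans hdk)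
  have hd0 : (d : ℝ) ≠ 0 := by exact_mod_cast (Nat.one_le_iff_ne_zero.1 hd)
  calc ∑ A ∈ (Finset.univ : Finset (Fin k)).powersetCard d, (∑ i ∈ A, f i) / (A.card : ℝ)
      = (∑ A ∈ (Finset.univ : Finset (Fin k)).powersetCard d, ∑ i ∈ A, f i) / d := by
        rw [Finset.sum_div]
        refine Finset.sum_congr rfl fun A hA => ?_
        rw [(Finset.mem_powersetCard.1 hA).2]
    _ = (k.choose d : ℝ) * ((∑ i, f i) / k) := by
        rw [hsum]
        field_simp
        linear_combination (∑ i, f i) * hchoose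

variable {kF kS : ℕ} {pol : Policy} {pF pS : ℝ}

theorem dispatchGiven_nonneg (hpF : pF ∈ Set.Icc (0 : ℝ) 1) (hpS : pS ∈ Set.Icc (0 : ℝ) 1)
    (x : QState kF kS) (A : Finset (Fin kF)) (B : Finset (Fin kS)) (s : Server kF kS) :
    0 ≤ dispatchGiven pol pF pS x A B s := by
  have h1 := hpF.1
  have h2 := hpS.1
  have h3 := sub_nonneg.2 hpF.2
  have h4 := sub_nonneg.2 hpS.2
  unfold dispatchGiven
  split_ifs <;> cases s <;> simp only [Sum.elim_inl, Sum.elim_inr] <;>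
    first
      | exact le_rfl
      | exact unifOn_nonneg _ _
      | exact mul_nonneg (by assumption) (unifOn_nonneg _ _)

theorem sum_dispatchGiven (x : QState kF kS) {A : Finset (Fin kF)} {B : Finset (Fin kS)}
    (hA : A.Nonempty) (hB : B.Nonempty) : ∑ s, dispatchGiven pol pF pS x A B s = 1 := by
  unfold dispatchGiven
  split_ifs with h1 h2
  · simp [sum_unifOn h1]
  · simp [← Finset.mul_sum, sum_unifOn h2, sum_unifOn (candidates_nonempty pol _ hA)]
  · simp [← Finset.mul_sum, sum_unifOn (candidates_nonempty pol _ hA),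
      sum_unifOn (candidates_nonempty pol _ hB)]

theorem sum_dispatchGiven_mul_le (hpF : pF ∈ Set.Icc (0 : ℝ) 1) (x : QState kF kS)
    {A : Finset (Fin kF)} {B : Finset (Fin kS)} (hA : A.Nonempty) (hB : B.Nonempty) :
    ∑ s, dispatchGiven pol pF 1 x A B s * (x s : ℝ) ≤
      pF * ((∑ i ∈ A, (x (Sum.inl i) : ℝ)) / A.card) +
        (1 - pF) * ((∑ j ∈ B, (x (Sum.inr j) : ℝ)) / B.card) := by
  have hpF' := sub_nonneg.2 hpF.2
  have hF := sum_unifOn_candidates_mul_le pol (fun i => x (Sum.inl i)) hA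
  have hS := sum_unifOn_candidates_mul_le pol (fun j => x (Sum.inr j)) hB
  have hrhs : 0 ≤ pF * ((∑ i ∈ A, (x (Sum.inl i) : ℝ)) / A.card) +
      (1 - pF) * ((∑ j ∈ B, (x (Sum.inr j) : ℝ)) / B.card) :=
    add_nonneg (mul_nonneg hpF.1 (by positivity)) (mul_nonneg hpF' (by positivity))
  unfold dispatchGiven
  split_ifs with h1 h2
  · have := sum_unifOn_idleIn_mul (fun i => x (Sum.inl i)) A
    simpa [this] using hrhs
  · have := sum_unifOn_idleIn_mul (fun j => x (Sum.inr j)) B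
    simpa [this] using hrhs
  · simp only [Fintype.sum_sum_type, Sum.elim_inl, Sum.elim_inr, mul_assoc, ← Finset.mul_sum]
    exact add_le_add (mul_le_mul_of_nonneg_left hF hpF.1) (mul_le_mul_of_nonneg_left hS hpF')

variable {dF dS : ℕ}

theorem nonempty_of_mem_powersetCard {k d : ℕ} (hd : 1 ≤ d) {A : Finset (Fin k)}
    (hA : A ∈ (Finset.univ : Finset (Fin k)).powersetCard d) : A.Nonempty :=
  Finset.card_pos.1 (by rw [(Finset.mem_powersetCard.1 hA).2]; exact hd)

theorem choose_mul_choose_pos (hdFk : dF ≤ kF) (hdSk : dS ≤ kS) :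
    (0 : ℝ) < (kF.choose dF : ℝ) * (kS.choose dS : ℝ) := by
  have h1 := Nat.choose_pos hdFk
  have h2 := Nat.choose_pos hdSk
  positivity

theorem isDispatchRule_dispatch (hdF : 1 ≤ dF) (hdFk : dF ≤ kF) (hdS : 1 ≤ dS) (hdSk : dS ≤ kS)
    (hpF : pF ∈ Set.Icc (0 : ℝ) 1) (hpS : pS ∈ Set.Icc (0 : ℝ) 1) :
    IsDispatchRule (kF := kF) (kS := kS) (dispatch pol dF dS pF pS) where
  nonneg x s := div_nonneg (Finset.sum_nonneg fun A _ => Finset.sum_nonneg fun B _ =>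
    dispatchGiven_nonneg hpF hpS x A B s) (choose_mul_choose_pos hdFk hdSk).le
  total x := by
    have hc := (choose_mul_choose_pos hdFk hdSk).ne'
    unfold dispatch
    rw [← Finset.sum_div, Finset.sum_comm, div_eq_one_iff_eq hc]
    calc ∑ A ∈ (Finset.univ : Finset (Fin kF)).powersetCard dF, ∑ s,
          ∑ B ∈ (Finset.univ : Finset (Fin kS)).powersetCard dS, dispatchGiven pol pF pS x A B s
        = ∑ A ∈ (Finset.univ : Finset (Fin kF)).powersetCard dF,
          ∑ B ∈ (Finset.univ : Finset (Fin kS)).powersetCard dS, (1 : ℝ) := by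
          refine Finset.sum_congr rfl fun A hA => ?_
          rw [Finset.sum_comm]
          exact Finset.sum_congr rfl fun B hB => sum_dispatchGiven x
            (nonempty_of_mem_powersetCard hdF hA) (nonempty_of_mem_powersetCard hdS hB)
      _ = _ := by simp [Finset.card_powersetCard]

theorem sum_dispatch_mul_le (hdF : 1 ≤ dF) (hdFk : dF ≤ kF) (hdS : 1 ≤ dS) (hdSk : dS ≤ kS)
    (hpF : pF ∈ Set.Icc (0 : ℝ) 1) (x : QState kF kS) :
    ∑ s, dispatch pol dF dS pF 1 x s * (x s : ℝ) ≤
      pF * ((∑ i, (x (Sum.inl i) : ℝ)) / kF) + (1 - pF) * ((∑ j, (x (Sum.inr j) : ℝ)) / kS) := by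
  have hc := choose_mul_choose_pos hdFk hdSk
  unfold dispatch
  simp only [div_mul_eq_mul_div]
  rw [← Finset.sum_div, div_le_iff₀ hc]
  calc ∑ s, (∑ A ∈ (Finset.univ : Finset (Fin kF)).powersetCard dF,
          ∑ B ∈ (Finset.univ : Finset (Fin kS)).powersetCard dS,
            dispatchGiven pol pF 1 x A B s) * (x s : ℝ)
      = ∑ A ∈ (Finset.univ : Finset (Fin kF)).powersetCard dF,
          ∑ B ∈ (Finset.univ : Finset (Fin kS)).powersetCard dS,
            ∑ s, dispatchGiven pol pF 1 x A B s * (x s : ℝ) := by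
        simp only [Finset.sum_mul]
        rw [Finset.sum_comm]
        exact Finset.sum_congr rfl fun A _ => Finset.sum_comm
    _ ≤ ∑ A ∈ (Finset.univ : Finset (Fin kF)).powersetCard dF,
          ∑ B ∈ (Finset.univ : Finset (Fin kS)).powersetCard dS,
            (pF * ((∑ i ∈ A, (x (Sum.inl i) : ℝ)) / A.card) +
              (1 - pF) * ((∑ j ∈ B, (x (Sum.inr j) : ℝ)) / B.card)) :=
        Finset.sum_le_sum fun A hA => Finset.sum_le_sum fun B hB =>
          sum_dispatchGiven_mul_le hpF x (nonempty_of_mem_powersetCard hdF hA)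
            (nonempty_of_mem_powersetCard hdS hB)
    _ = _ := by
        simp only [Finset.sum_add_distrib, Finset.sum_const, Finset.card_powersetCard,
          Finset.card_univ, Fintype.card_fin, nsmul_eq_mul, ← Finset.mul_sum]
        rw [sum_powersetCard_mean hdF hdFk, sum_powersetCard_mean hdS hdSk]
        ring

theorem dispatch_pos (hpF : pF ∈ Set.Icc (0 : ℝ) 1) (hpS : pS ∈ Set.Icc (0 : ℝ) 1)
    (hdFk : dF ≤ kF) (hdSk : dS ≤ kS) {x : QState kF kS} {s : Server kF kS}
    {A : Finset (Fin kF)} {B : Finset (Fin kS)} (hA : A.card = dF) (hB : B.card = dS)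
    (h : 0 < dispatchGiven pol pF pS x A B s) : 0 < dispatch pol dF dS pF pS x s := by
  have hnn := fun A B => dispatchGiven_nonneg (pol := pol) hpF hpS x A B s
  refine div_pos ?_ (choose_mul_choose_pos hdFk hdSk)
  refine Finset.sum_pos' (fun A _ => Finset.sum_nonneg fun B _ => hnn A B)
    ⟨A, by simp [Finset.mem_powersetCard, hA], ?_⟩
  exact Finset.sum_pos' (fun B _ => hnn A B) ⟨B, by simp [Finset.mem_powersetCard, hB], h⟩

theorem exists_finset_mem_card {k d : ℕ} (hd : 1 ≤ d) (hdk : d ≤ k) (i : Fin k) :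
    ∃ A : Finset (Fin k), i ∈ A ∧ A.card = d := by
  obtain ⟨A, hA, -, hc⟩ := Finset.exists_subsuperset_card_eq (Finset.subset_univ {i})
    (by simpa using hd) (by simpa using hdk)
  exact ⟨A, Finset.singleton_subset_iff.1 hA, hc⟩

theorem exists_finset_card {k d : ℕ} (hdk : d ≤ k) : ∃ A : Finset (Fin k), A.card = d := by
  obtain ⟨A, -, hc⟩ := Finset.exists_subset_card_eq (s := (Finset.univ : Finset (Fin k)))
    (by simpa using hdk)
  exact ⟨A, hc⟩

theorem dispatch_fast_pos (hdF : 1 ≤ dF) (hdFk : dF ≤ kF) (hdSk : dS ≤ kS)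
    (hpF : pF ∈ Set.Icc (0 : ℝ) 1) (hpS : pS ∈ Set.Icc (0 : ℝ) 1) (hpF0 : 0 < pF)
    {x : QState kF kS} {i : Fin kF} (hmin : ∀ i', x (Sum.inl i) ≤ x (Sum.inl i'))
    (h : x (Sum.inl i) = 0 ∨ ∀ j, 0 < x (Sum.inr j)) :
    0 < dispatch pol dF dS pF pS x (Sum.inl i) := by
  obtain ⟨A, hiA, hA⟩ := exists_finset_mem_card hdF hdFk i
  obtain ⟨B, hB⟩ := exists_finset_card hdSk
  refine dispatch_pos hpF hpS hdFk hdSk hA hB ?_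
  unfold dispatchGiven
  rcases Nat.eq_zero_or_pos (x (Sum.inl i)) with h0 | h0
  · have hm : i ∈ idleIn (fun i => x (Sum.inl i)) A := Finset.mem_filter.2 ⟨hiA, h0⟩
    rw [if_pos ⟨i, hm⟩]
    exact unifOn_pos hm
  · rw [if_neg (idleIn_eq_empty (fun i' => h0.trans_le (hmin i')) A),
      if_neg (idleIn_eq_empty (h.resolve_left h0.ne') B)]
    exact mul_pos hpF0 (unifOn_pos (mem_candidates pol hiA hmin))

theorem dispatch_slow_pos (hdFk : dF ≤ kF) (hdS : 1 ≤ dS) (hdSk : dS ≤ kS)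
    (hpF : pF ∈ Set.Icc (0 : ℝ) 1) (hpS : pS ∈ Set.Icc (0 : ℝ) 1) (hpF1 : pF < 1) (hpS0 : 0 < pS)
    {x : QState kF kS} {j : Fin kS} (hmin : ∀ j', x (Sum.inr j) ≤ x (Sum.inr j'))
    (h : ∀ i, 0 < x (Sum.inl i)) : 0 < dispatch pol dF dS pF pS x (Sum.inr j) := by
  obtain ⟨A, hA⟩ := exists_finset_card hdFk
  obtain ⟨B, hjB, hB⟩ := exists_finset_mem_card hdS hdSk j
  refine dispatch_pos hpF hpS hdFk hdSk hA hB ?_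
  unfold dispatchGiven
  rw [if_neg (idleIn_eq_empty h A)]
  rcases Nat.eq_zero_or_pos (x (Sum.inr j)) with h0 | h0
  · have hm : j ∈ idleIn (fun j => x (Sum.inr j)) B := Finset.mem_filter.2 ⟨hjB, h0⟩
    rw [if_pos ⟨j, hm⟩]
    exact mul_pos hpS0 (unifOn_pos hm)
  · rw [if_neg (idleIn_eq_empty (fun j' => h0.trans_le (hmin j')) B)]
    exact mul_pos (sub_pos.2 hpF1) (unifOn_pos (mem_candidates pol hjB hmin))

theorem continuous_dispatch (x : QState kF kS) (s : Server kF kS) :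
    Continuous fun p : ℝ × ℝ => dispatch pol dF dS p.1 p.2 x s := by
  unfold dispatch dispatchGiven
  refine Continuous.div_const (continuous_finsetSum _ fun A _ =>
    continuous_finsetSum _ fun B _ => ?_) _
  split_ifs <;> cases s <;> simp only [Sum.elim_inl, Sum.elim_inr] <;> fun_prop

end Dispatching


section QueueRates

variable {kF kS : ℕ} {lam μF μS : ℝ} {D : QState kF kS → Server kF kS → ℝ}

theorem serviceRate_pos (hμF : 0 < μF) (hμS : 0 < μS) (s : Server kF kS) :
    0 < serviceRate μF μS s := by
  cases s <;> simpa [serviceRate]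

theorem sum_serviceRate (μF μS : ℝ) :
    ∑ s : Server kF kS, serviceRate μF μS s = kF * μF + kS * μS := by
  simp [serviceRate]

theorem sum_update_succ (x : QState kF kS) (s : Server kF kS) :
    ∑ t, Function.update x s (x s + 1) t = ∑ t, x t + 1 := by
  rw [Finset.sum_update_of_mem (Finset.mem_univ s),
    Finset.sum_eq_add_sum_sdiff_singleton_of_mem (Finset.mem_univ s) x]
  ring

theorem sum_update_pred {x : QState kF kS} {s : Server kF kS} (h : 0 < x s) :
    ∑ t, Function.update x s (x s - 1) t + 1 = ∑ t, x t := by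
  rw [Finset.sum_update_of_mem (Finset.mem_univ s),
    Finset.sum_eq_add_sum_sdiff_singleton_of_mem (Finset.mem_univ s) x]
  omega

theorem sum_sq_update (x : QState kF kS) (s : Server kF kS) (m : ℕ) :
    ∑ t, (Function.update x s m t : ℝ) ^ 2 = ∑ t, (x t : ℝ) ^ 2 + (m : ℝ) ^ 2 - (x s : ℝ) ^ 2 := by
  have e : ∀ t, (Function.update x s m t : ℝ) ^ 2 =
      Function.update (fun t => (x t : ℝ) ^ 2) s ((m : ℝ) ^ 2) t := by
    intro t
    by_cases h : t = s
    · subst h; simp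
    · simp [h]
  simp_rw [e]
  rw [Finset.sum_update_of_mem (Finset.mem_univ s),
    Finset.sum_eq_add_sum_sdiff_singleton_of_mem (Finset.mem_univ s) fun t => (x t : ℝ) ^ 2]
  ring

theorem finite_setOf_sum_le (n : ℕ) : {x : QState kF kS | ∑ s, x s ≤ n}.Finite := by
  refine (Set.finite_Icc (0 : QState kF kS) fun _ => n).subset fun x hx => ?_
  exact ⟨fun _ => Nat.zero_le _, fun s =>
    (Finset.single_le_sum (f := x) (fun _ _ => Nat.zero_le _) (Finset.mem_univ s)).trans hx⟩

theorem tsum_queueRate_mul (x : QState kF kS) (f : QState kF kS → ℝ≥0∞) :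
    ∑' y, queueRate lam μF μS D x y * f y =
      ∑ s, (ENNReal.ofReal (lam * ((kF : ℝ) + kS) * D x s) * f (Function.update x s (x s + 1)) +
        if 0 < x s then
          ENNReal.ofReal (serviceRate μF μS s) * f (Function.update x s (x s - 1)) else 0) := by
  simp only [queueRate, Finset.sum_mul, add_mul, ite_mul, zero_mul]
  rw [Summable.tsum_finsetSum fun _ _ => ENNReal.summable]
  refine Finset.sum_congr rfl fun s _ => ?_
  rw [ENNReal.tsum_add, tsum_ite_eq]
  congr 1
  by_cases h : 0 < x s
  · simp only [h, true_and, if_true]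
    rw [tsum_ite_eq]
  · simp [h]

theorem exitRate_queueRate (x : QState kF kS) :
    Chain.exitRate (queueRate lam μF μS D) x =
      ∑ s, (ENNReal.ofReal (lam * ((kF : ℝ) + kS) * D x s) +
        if 0 < x s then ENNReal.ofReal (serviceRate μF μS s) else 0) := by
  have := tsum_queueRate_mul (lam := lam) (μF := μF) (μS := μS) (D := D) x fun _ => 1
  simpa only [mul_one, Chain.exitRate] using this

theorem sum_arrivalRate (hlam : 0 < lam) (hD : IsDispatchRule D) (x : QState kF kS) :
    ∑ s, ENNReal.ofReal (lam * ((kF : ℝ) + kS) * D x s) =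
      ENNReal.ofReal (lam * ((kF : ℝ) + kS)) := by
  have ha : 0 ≤ lam * ((kF : ℝ) + kS) := by positivity
  rw [← ENNReal.ofReal_sum_of_nonneg fun s _ => mul_nonneg ha (hD.nonneg x s), ← Finset.mul_sum,
    hD.total, mul_one]

/-- Total rate of service completions. -/
def completionRate (μF μS : ℝ) (x : QState kF kS) : ℝ≥0∞ :=
  ∑ s, if 0 < x s then ENNReal.ofReal (serviceRate μF μS s) else 0

theorem completionRate_le (hμF : 0 < μF) (hμS : 0 < μS) (x : QState kF kS) :
    completionRate μF μS x ≤ ENNReal.ofReal (kF * μF + kS * μS) := by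
  rw [← sum_serviceRate, ENNReal.ofReal_sum_of_nonneg fun s _ => (serviceRate_pos hμF hμS s).le]
  refine Finset.sum_le_sum fun s _ => ?_
  split_ifs
  · exact le_rfl
  · exact zero_le

theorem exitRate_eq_add (hlam : 0 < lam) (hD : IsDispatchRule D) (x : QState kF kS) :
    Chain.exitRate (queueRate lam μF μS D) x =
      ENNReal.ofReal (lam * ((kF : ℝ) + kS)) + completionRate μF μS x := by
  rw [exitRate_queueRate, Finset.sum_add_distrib, sum_arrivalRate hlam hD, completionRate]

theorem exitRate_ne_zero (hk : 0 < kF) (hlam : 0 < lam) (hD : IsDispatchRule D)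
    (x : QState kF kS) : Chain.exitRate (queueRate lam μF μS D) x ≠ 0 := by
  rw [exitRate_eq_add hlam hD]
  have : 0 < lam * ((kF : ℝ) + kS) := by positivity
  exact (lt_of_lt_of_le (ENNReal.ofReal_pos.2 this) le_self_add).ne'

theorem exitRate_le (hlam : 0 < lam) (hμF : 0 < μF) (hμS : 0 < μS) (hD : IsDispatchRule D)
    (x : QState kF kS) : Chain.exitRate (queueRate lam μF μS D) x ≤
      ENNReal.ofReal (lam * ((kF : ℝ) + kS)) + ENNReal.ofReal (kF * μF + kS * μS) := by
  rw [exitRate_eq_add hlam hD]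
  gcongr
  exact completionRate_le hμF hμS x

theorem queueRate_ne_top (x y : QState kF kS) : queueRate lam μF μS D x y ≠ ∞ := by
  refine ENNReal.sum_ne_top.2 fun s _ => ENNReal.add_ne_top.2 ⟨?_, ?_⟩ <;> split_ifs <;> simp

/-- The states from which `y` can be reached in one transition. -/
def predecessors (y : QState kF kS) : Finset (QState kF kS) :=
  Finset.univ.image (fun s => Function.update y s (y s - 1)) ∪
    Finset.univ.image (fun s => Function.update y s (y s + 1))

theorem queueRate_eq_zero {x y : QState kF kS} (h : x ∉ predecessors y) :
    queueRate lam μF μS D x y = 0 := by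
  refine Finset.sum_eq_zero fun s _ => ?_
  have h1 : ¬ y = Function.update x s (x s + 1) := by
    rintro rfl
    refine h (Finset.mem_union_left _ (Finset.mem_image.2 ⟨s, Finset.mem_univ s, ?_⟩))
    simp
  have h2 : ¬ (0 < x s ∧ y = Function.update x s (x s - 1)) := by
    rintro ⟨h0, rfl⟩
    refine h (Finset.mem_union_right _ (Finset.mem_image.2 ⟨s, Finset.mem_univ s, ?_⟩))
    simp [Nat.sub_add_cancel h0]
  simp [h1, h2]

theorem finite_queueRate_ne_zero (y : QState kF kS) :
    {x | queueRate lam μF μS D x y ≠ 0}.Finite :=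
  (predecessors y).finite_toSet.subset fun _ hx => by
    by_contra h
    exact hx (queueRate_eq_zero h)

theorem queueRate_arrival_pos (hk : 0 < kF) (hlam : 0 < lam) {x : QState kF kS}
    {s : Server kF kS} (h : 0 < D x s) :
    0 < queueRate lam μF μS D x (Function.update x s (x s + 1)) := by
  have hp : 0 < lam * ((kF : ℝ) + kS) * D x s := by positivity
  refine lt_of_lt_of_le ?_ (Finset.single_le_sum (fun _ _ => zero_le) (Finset.mem_univ s))
  rw [if_pos rfl]
  exact (ENNReal.ofReal_pos.2 hp).trans_le le_self_add

theorem queueRate_completion_pos (hμF : 0 < μF) (hμS : 0 < μS) {x : QState kF kS}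
    {s : Server kF kS} (h : 0 < x s) :
    0 < queueRate lam μF μS D x (Function.update x s (x s - 1)) := by
  refine lt_of_lt_of_le ?_ (Finset.single_le_sum (fun _ _ => zero_le) (Finset.mem_univ s))
  rw [if_pos (⟨h, rfl⟩ : 0 < x s ∧ _)]
  exact (ENNReal.ofReal_pos.2 (serviceRate_pos hμF hμS s)).trans_le le_add_self

theorem reachable_of_le (hμF : 0 < μF) (hμS : 0 < μS) {z y : QState kF kS} (h : z ≤ y) :
    Chain.Reachable (queueRate lam μF μS D) y z := by
  induction hn : ∑ s, y s using Nat.strong_induction_on generalizing y with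
  | _ n ih =>
    by_cases hzy : z = y
    · subst hzy; exact Relation.ReflTransGen.refl
    · obtain ⟨s, hs⟩ := (Pi.lt_def.1 (lt_of_le_of_ne h hzy)).2
      have h0 : 0 < y s := (Nat.zero_le _).trans_lt hs
      have hsum := sum_update_pred h0
      refine Relation.ReflTransGen.head (queueRate_completion_pos hμF hμS h0)
        (ih _ (by omega) ?_ rfl)
      intro t
      by_cases ht : t = s
      · subst ht; simp only [Function.update_self]; omega
      · simpa [ht] using h t

/-- If a shortest queue within the class `T` can always be joined while it is shorter than `M`,
then all queues of `T` can be filled up to the level `M`. -/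
theorem exists_reachable_ge (hk : 0 < kF) (hlam : 0 < lam) (T : Finset (Server kF kS)) (M : ℕ)
    (x₀ : QState kF kS)
    (h : ∀ x, x₀ ≤ x → ∀ s ∈ T, x s < M → (∀ t ∈ T, x s ≤ x t) → 0 < D x s) :
    ∃ y, x₀ ≤ y ∧ Chain.Reachable (queueRate lam μF μS D) x₀ y ∧ ∀ s ∈ T, M ≤ y s := by
  suffices H : ∀ n, ∀ x, x₀ ≤ x → ∑ s ∈ T, (M - x s) = n →
      ∃ y, x ≤ y ∧ Chain.Reachable (queueRate lam μF μS D) x y ∧ ∀ s ∈ T, M ≤ y s from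
    H _ x₀ le_rfl rfl
  intro n
  induction n using Nat.strong_induction_on with
  | _ n ih =>
    intro x hx hn
    by_cases hall : ∀ s ∈ T, M ≤ x s
    · exact ⟨x, le_rfl, Relation.ReflTransGen.refl, hall⟩
    · push Not at hall
      obtain ⟨s', hs'T, hs'⟩ := hall
      obtain ⟨s, hsT, hmin⟩ := T.exists_min_image x ⟨s', hs'T⟩
      have hsM : x s < M := (hmin s' hs'T).trans_lt hs'
      have hle : x ≤ Function.update x s (x s + 1) := by
        intro t
        by_cases ht : t = s
        · subst ht; simp
        · simp [ht]
      have hlt : ∑ t ∈ T, (M - Function.update x s (x s + 1) t) < n := by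
        rw [← hn]
        refine Finset.sum_lt_sum (fun t _ => Nat.sub_le_sub_left (hle t) M) ⟨s, hsT, ?_⟩
        simp only [Function.update_self]; omega
      obtain ⟨y, hy, hr, hM⟩ := ih _ hlt _ (hx.trans hle) rfl
      exact ⟨y, hle.trans hy, Relation.ReflTransGen.head
        (queueRate_arrival_pos hk hlam (h x hx s hsT hsM hmin)) hr, hM⟩

end QueueRates

section Instability

variable {kF kS : ℕ} {lam μF μS : ℝ} {D : QState kF kS → Server kF kS → ℝ}

/-- Probability that `m` jobs are in the system. -/
def levelMass (π : QState kF kS → ℝ≥0∞) (m : ℕ) : ℝ≥0∞ :=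
  ∑' x, if ∑ s, x s = m then π x else 0

theorem tsum_levelMass (π : QState kF kS → ℝ≥0∞) : ∑' m, levelMass π m = ∑' x, π x := by
  simp only [levelMass]
  rw [ENNReal.tsum_comm]
  refine tsum_congr fun x => ?_
  rw [tsum_eq_single (∑ s, x s) fun m hm => if_neg hm.symm, if_pos rfl]

/-- Flow across the cut between at most `m` and more than `m` jobs. -/
theorem arrival_mul_levelMass_le (hlam : 0 < lam) (hμF : 0 < μF) (hμS : 0 < μS)
    (hD : IsDispatchRule D) {π : QState kF kS → ℝ≥0∞}
    (hπ : Chain.IsStationary (queueRate lam μF μS D) π) (m : ℕ) :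
    ENNReal.ofReal (lam * ((kF : ℝ) + kS)) * levelMass π m ≤
      ENNReal.ofReal (kF * μF + kS * μS) * levelMass π (m + 1) := by
  set a := ENNReal.ofReal (lam * ((kF : ℝ) + kS)) with ha
  set b := ENNReal.ofReal (kF * μF + kS * μS) with hb
  set q := queueRate lam μF μS D with hq
  set f : QState kF kS → ℝ≥0∞ := fun x => if ∑ s, x s ≤ m then 1 else 0 with hf
  have hflow : ∀ x, ∑' y, q x y * f y =
      (if ∑ s, x s + 1 ≤ m then a else 0) +
        if ∑ s, x s ≤ m + 1 then completionRate μF μS x else 0 := by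
    intro x
    rw [hq, tsum_queueRate_mul, Finset.sum_add_distrib]
    congr 1
    · simp only [hf, sum_update_succ]
      rw [← Finset.sum_mul, sum_arrivalRate hlam hD]
      split_ifs <;> simp [ha]
    · by_cases h : ∑ s, x s ≤ m + 1
      · rw [if_pos h, completionRate]
        refine Finset.sum_congr rfl fun s _ => ?_
        by_cases hs : 0 < x s
        · have := sum_update_pred hs
          have h' : ∑ t, Function.update x s (x s - 1) t ≤ m := by omega
          simp only [hf, if_pos hs, if_pos h', mul_one]
        · simp [hs]
      · rw [if_neg h]
        refine Finset.sum_eq_zero fun s _ => ?_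
        by_cases hs : 0 < x s
        · have := sum_update_pred hs
          have h' : ¬ ∑ t, Function.update x s (x s - 1) t ≤ m := by omega
          simp only [hf, if_pos hs, if_neg h', mul_zero]
        · simp [hs]
  have hpt : ∀ x, ∑' y, q x y * f y + a * (if ∑ s, x s = m then 1 else 0) ≤
      Chain.exitRate q x * f x + b * (if ∑ s, x s = m + 1 then 1 else 0) := by
    intro x
    rw [hflow, hq, exitRate_eq_add hlam hD, ← ha]
    have hc := completionRate_le hμF hμS x
    simp only [hf]
    generalize ∑ s, x s = N
    rcases lt_trichotomy N m with h | h | h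
    · have h1 : N + 1 ≤ m := h
      have h2 : N ≤ m + 1 := by omega
      have h3 : N ≠ m + 1 := by omega
      simp [h1, h2, h3, h.ne, h.le]
    · simp [h, add_comm]
    · have h1 : ¬ N + 1 ≤ m := by omega
      have h2 : ¬ N ≤ m := by omega
      have h3 : N ≠ m := by omega
      by_cases h4 : N = m + 1
      · simpa [h4] using hc
      · have h5 : ¬ N ≤ m + 1 := by omega
        simp [h1, h2, h3, h4, h5]
  have hbal : ∑' x, π x * ∑' y, q x y * f y = ∑' x, π x * (Chain.exitRate q x * f x) := by
    calc ∑' x, π x * ∑' y, q x y * f y = ∑' y, (∑' x, π x * q x y) * f y := by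
          simp only [← ENNReal.tsum_mul_left, ← ENNReal.tsum_mul_right]
          rw [ENNReal.tsum_comm]
          simp only [mul_assoc]
      _ = _ := by simp only [hπ.balance, mul_assoc]
  have hfin : ∑' x, π x * (Chain.exitRate q x * f x) ≠ ∞ := by
    refine ne_top_of_le_ne_top (b := a + b) (by simp [ha, hb]) ?_
    calc ∑' x, π x * (Chain.exitRate q x * f x) ≤ ∑' x, π x * ((a + b) * 1) := by
          refine ENNReal.tsum_le_tsum fun x => ?_
          gcongr
          · exact exitRate_le hlam hμF hμS hD x
          · simp only [hf]; split_ifs <;> simp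
      _ = a + b := by rw [ENNReal.tsum_mul_right, hπ.total]; simp
  have hmass : ∀ (c : ℝ≥0∞) (n : ℕ),
      ∑' x, π x * (c * (if ∑ s, x s = n then 1 else 0)) = c * levelMass π n := by
    intro c n
    rw [levelMass, ← ENNReal.tsum_mul_left]
    refine tsum_congr fun x => ?_
    split_ifs
    · ring
    · simp
  have hsum := ENNReal.tsum_le_tsum fun x => mul_le_mul_right (hpt x) (π x)
  simp only [mul_add] at hsum
  rw [ENNReal.tsum_add, ENNReal.tsum_add, hmass, hmass, hbal] at hsum
  exact (ENNReal.add_le_add_iff_left hfin).1 hsum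

theorem not_isStable_of_overload (hk : 0 < kF) (hlam : 0 < lam) (hμF : 0 < μF) (hμS : 0 < μS)
    (hload : kF * μF + kS * μS ≤ lam * ((kF : ℝ) + kS)) (hD : IsDispatchRule D) :
    ¬ IsStable (queueRate lam μF μS D) := by
  intro hst
  obtain ⟨π, hπ, h0⟩ := Chain.exists_isStationary_of_positiveRecurrent
    (by simp) (exitRate_le hlam hμF hμS hD) (exitRate_ne_zero hk hlam hD)
    (hst (emptyState kF kS) Relation.ReflTransGen.refl)
  have hpos : 0 < kF * μF + kS * μS := by positivity
  have hmono : ∀ m, levelMass π m ≤ levelMass π (m + 1) := by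
    intro m
    refine (ENNReal.mul_le_mul_iff_right (ENNReal.ofReal_pos.2 hpos).ne' ENNReal.ofReal_ne_top).1
      (le_trans ?_ (arrival_mul_levelMass_le hlam hμF hμS hD hπ m))
    gcongr
  have hge : ∀ m, levelMass π 0 ≤ levelMass π m := fun m =>
    monotone_nat_of_le_succ hmono (Nat.zero_le m)
  have hm0 : levelMass π 0 ≠ 0 := by
    intro h
    have := ENNReal.tsum_eq_zero.1 h (emptyState kF kS)
    simp [emptyState] at this
    exact h0 this
  have htop : ∑' m : ℕ, levelMass π m = ∞ := top_le_iff.1 <|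
    (ENNReal.tsum_const_eq_top_of_ne_zero hm0).symm.le.trans (ENNReal.tsum_le_tsum hge)
  rw [tsum_levelMass, hπ.total] at htop
  exact ENNReal.one_ne_top htop

end Instability


section Stability

variable {kF kS : ℕ} {lam μF μS : ℝ} {D : QState kF kS → Server kF kS → ℝ}

/-- Sum of the squared queue lengths. -/
def sumSq (x : QState kF kS) : ℝ := ∑ s, (x s : ℝ) ^ 2

theorem sumSq_nonneg (x : QState kF kS) : 0 ≤ sumSq x :=
  Finset.sum_nonneg fun _ _ => sq_nonneg _

theorem sumSq_update_succ (x : QState kF kS) (s : Server kF kS) :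
    sumSq (Function.update x s (x s + 1)) = sumSq x + 2 * (x s : ℝ) + 1 := by
  rw [sumSq, sum_sq_update, sumSq]; push_cast; ring

theorem sumSq_update_pred {x : QState kF kS} {s : Server kF kS} (h : 0 < x s) :
    sumSq (Function.update x s (x s - 1)) = sumSq x - 2 * (x s : ℝ) + 1 := by
  rw [sumSq, sum_sq_update, sumSq, Nat.cast_sub h]; push_cast; ring

theorem exitRate_queueRate_eq_ofReal (hlam : 0 < lam) (hμF : 0 < μF) (hμS : 0 < μS)
    (hD : IsDispatchRule D) (x : QState kF kS) :
    Chain.exitRate (queueRate lam μF μS D) x = ENNReal.ofReal (∑ s,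
      (lam * ((kF : ℝ) + kS) * D x s + if 0 < x s then serviceRate μF μS s else 0)) := by
  have ha : 0 ≤ lam * ((kF : ℝ) + kS) := by positivity
  have hc : ∀ s, 0 ≤ if 0 < x s then serviceRate μF μS s else 0 := fun s => by
    split_ifs
    · exact (serviceRate_pos hμF hμS s).le
    · exact le_rfl
  rw [exitRate_queueRate, ENNReal.ofReal_sum_of_nonneg fun s _ =>
    add_nonneg (mul_nonneg ha (hD.nonneg x s)) (hc s)]
  refine Finset.sum_congr rfl fun s _ => ?_
  rw [ENNReal.ofReal_add (mul_nonneg ha (hD.nonneg x s)) (hc s)]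
  split_ifs <;> simp

theorem arrival_mul_sumSq_nonneg (hlam : 0 < lam) (hD : IsDispatchRule D) (x : QState kF kS)
    (s : Server kF kS) : 0 ≤ lam * ((kF : ℝ) + kS) * D x s * (sumSq x + 2 * (x s : ℝ) + 1) := by
  have h1 := sumSq_nonneg x
  have h2 := hD.nonneg x s
  positivity

theorem completion_mul_sumSq_nonneg (hμF : 0 < μF) (hμS : 0 < μS) (x : QState kF kS)
    (s : Server kF kS) :
    0 ≤ (if 0 < x s then serviceRate μF μS s else 0) * (sumSq x - 2 * (x s : ℝ) + 1) := by
  split_ifs with h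
  · rw [← sumSq_update_pred h]
    exact mul_nonneg (serviceRate_pos hμF hμS s).le (sumSq_nonneg _)
  · simp

theorem tsum_queueRate_mul_sumSq (hlam : 0 < lam) (hμF : 0 < μF) (hμS : 0 < μS)
    (hD : IsDispatchRule D) (x : QState kF kS) :
    ∑' y, queueRate lam μF μS D x y * ENNReal.ofReal (sumSq y) = ENNReal.ofReal (∑ s,
      (lam * ((kF : ℝ) + kS) * D x s * (sumSq x + 2 * (x s : ℝ) + 1) +
        (if 0 < x s then serviceRate μF μS s else 0) * (sumSq x - 2 * (x s : ℝ) + 1))) := by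
  have ha : 0 ≤ lam * ((kF : ℝ) + kS) := by positivity
  have h1 : ∀ s, 0 ≤ lam * ((kF : ℝ) + kS) * D x s := fun s => mul_nonneg ha (hD.nonneg x s)
  have h2 := arrival_mul_sumSq_nonneg hlam hD x
  have h3 := completion_mul_sumSq_nonneg hμF hμS x
  rw [tsum_queueRate_mul, ENNReal.ofReal_sum_of_nonneg fun s _ => add_nonneg (h2 s) (h3 s)]
  refine Finset.sum_congr rfl fun s _ => ?_
  rw [ENNReal.ofReal_add (h2 s) (h3 s), ENNReal.ofReal_mul (h1 s), sumSq_update_succ]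
  split_ifs with h
  · rw [sumSq_update_pred h, ENNReal.ofReal_mul (serviceRate_pos hμF hμS s).le]
  · simp

theorem drift_sumSq_le (hlam : 0 < lam) (hlam1 : lam < 1) (hμF : 0 < μF) (hμS : 0 < μS)
    (hD : IsDispatchRule D) (x : QState kF kS)
    (hload : ((kF : ℝ) + kS) * ∑ s, D x s * (x s : ℝ) ≤ ∑ s, serviceRate μF μS s * (x s : ℝ)) :
    ∑ s, (lam * ((kF : ℝ) + kS) * D x s * (sumSq x + 2 * (x s : ℝ) + 1) +
        (if 0 < x s then serviceRate μF μS s else 0) * (sumSq x - 2 * (x s : ℝ) + 1)) +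
      2 * (1 - lam) * min μF μS * ∑ s, (x s : ℝ) ≤
    (∑ s, (lam * ((kF : ℝ) + kS) * D x s + if 0 < x s then serviceRate μF μS s else 0)) * sumSq x +
      (lam * ((kF : ℝ) + kS) + (kF * μF + kS * μS)) := by
  set a := lam * ((kF : ℝ) + kS) with ha
  set c : Server kF kS → ℝ := fun s => if 0 < x s then serviceRate μF μS s else 0 with hc
  have hcx : ∀ s, c s * (x s : ℝ) = serviceRate μF μS s * (x s : ℝ) := by
    intro s
    simp only [hc]
    split_ifs with h
    · rfl
    · simp [Nat.eq_zero_of_not_pos h]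
  have hcle : ∑ s, c s ≤ kF * μF + kS * μS := by
    rw [← sum_serviceRate]
    refine Finset.sum_le_sum fun s _ => ?_
    simp only [hc]
    split_ifs
    · exact le_rfl
    · exact (serviceRate_pos hμF hμS s).le
  have hmin : min μF μS * ∑ s, (x s : ℝ) ≤ ∑ s, serviceRate μF μS s * (x s : ℝ) := by
    rw [Finset.mul_sum]
    refine Finset.sum_le_sum fun s _ => mul_le_mul_of_nonneg_right ?_ (Nat.cast_nonneg _)
    cases s <;> simp [serviceRate]
  have e1 : ∑ s, (a * D x s * (sumSq x + 2 * (x s : ℝ) + 1) +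
      c s * (sumSq x - 2 * (x s : ℝ) + 1)) =
      (∑ s, (a * D x s + c s)) * sumSq x + 2 * (a * ∑ s, D x s * (x s : ℝ)) + a * ∑ s, D x s -
        2 * ∑ s, c s * (x s : ℝ) + ∑ s, c s := by
    simp only [Finset.mul_sum, Finset.sum_mul, ← Finset.sum_add_distrib, ← Finset.sum_sub_distrib]
    exact Finset.sum_congr rfl fun s _ => by ring
  have e2 : ∑ s, c s * (x s : ℝ) = ∑ s, serviceRate μF μS s * (x s : ℝ) :=
    Finset.sum_congr rfl fun s _ => hcx s
  rw [e1, e2, hD.total]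
  have h1 := mul_le_mul_of_nonneg_left hload hlam.le
  have h2 := mul_le_mul_of_nonneg_left hmin (sub_pos.2 hlam1).le
  rw [ha] at *
  linarith

theorem finite_setOf_mul_sum_le {ε : ℝ≥0∞} (hε : ε ≠ 0) (hεT : ε ≠ ∞) (n : ℕ) :
    {x : QState kF kS | ε * ((∑ s, x s : ℕ) : ℝ≥0∞) ≤ n}.Finite := by
  obtain ⟨m, hm⟩ := ENNReal.exists_nat_gt
    (ENNReal.div_ne_top (ENNReal.natCast_ne_top n) hε)
  refine (finite_setOf_sum_le m).subset fun x hx => ?_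
  have h : ((∑ s, x s : ℕ) : ℝ≥0∞) ≤ n / ε := by
    rw [ENNReal.le_div_iff_mul_le (Or.inl hε) (Or.inl hεT), mul_comm]
    exact hx
  exact_mod_cast h.trans hm.le

/-- If the dispatching rule sends no more work to long queues than proportional splitting does,
then the system has a stationary distribution with finite mean number of jobs. -/
theorem exists_isStationary_finite_mean (hk : 0 < kF) (hlam : 0 < lam) (hlam1 : lam < 1)
    (hμF : 0 < μF) (hμS : 0 < μS) (hD : IsDispatchRule D)
    (hload : ∀ x, ((kF : ℝ) + kS) * ∑ s, D x s * (x s : ℝ) ≤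
      ∑ s, serviceRate μF μS s * (x s : ℝ)) :
    ∃ π, Chain.IsStationary (queueRate lam μF μS D) π ∧
      ∑' x, π x * ((∑ s, x s : ℕ) : ℝ≥0∞) ≠ ∞ := by
  have hε : 0 < 2 * (1 - lam) * min μF μS :=
    mul_pos (mul_pos two_pos (sub_pos.2 hlam1)) (lt_min hμF hμS)
  set ε := 2 * (1 - lam) * min μF μS with hεdef
  have hε0 : ENNReal.ofReal ε ≠ 0 := (ENNReal.ofReal_pos.2 hε).ne'
  have ha : 0 < lam * ((kF : ℝ) + kS) := by positivity
  have hb : 0 ≤ kF * μF + kS * μS := by positivity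
  obtain ⟨π, hπ, hfin⟩ := Chain.exists_isStationary_of_drift (q := queueRate lam μF μS D)
    (Λ := ENNReal.ofReal (lam * ((kF : ℝ) + kS)) + ENNReal.ofReal (kF * μF + kS * μS))
    ((ENNReal.ofReal_pos.2 ha).trans_le le_self_add).ne' (by simp)
    (exitRate_le hlam hμF hμS hD) finite_queueRate_ne_zero (emptyState kF kS)
    (V := fun x => ENNReal.ofReal (sumSq x))
    (W := fun x => ENNReal.ofReal ε * ((∑ s, x s : ℕ) : ℝ≥0∞))
    (C := ENNReal.ofReal (lam * ((kF : ℝ) + kS) + (kF * μF + kS * μS)))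
    ENNReal.ofReal_ne_top
    (fun x => ENNReal.mul_ne_top ENNReal.ofReal_ne_top (ENNReal.natCast_ne_top _))
    (finite_setOf_mul_sum_le hε0 ENNReal.ofReal_ne_top) ENNReal.ofReal_ne_top (by
      intro x
      have hd := drift_sumSq_le hlam hlam1 hμF hμS hD x (hload x)
      have hnn : 0 ≤ ∑ s, (lam * ((kF : ℝ) + kS) * D x s +
          if 0 < x s then serviceRate μF μS s else 0) := by
        refine Finset.sum_nonneg fun s _ => add_nonneg (mul_nonneg ha.le (hD.nonneg x s)) ?_
        split_ifs
        · exact (serviceRate_pos hμF hμS s).le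
        · exact le_rfl
      have hN : ENNReal.ofReal ε * ((∑ s, x s : ℕ) : ℝ≥0∞) =
          ENNReal.ofReal (ε * ∑ s, (x s : ℝ)) := by
        rw [ENNReal.ofReal_mul hε.le, ← Nat.cast_sum, ENNReal.ofReal_natCast]
      rw [tsum_queueRate_mul_sumSq hlam hμF hμS hD,
        exitRate_queueRate_eq_ofReal hlam hμF hμS hD, hN, ← ENNReal.ofReal_mul hnn,
        ← ENNReal.ofReal_add (mul_nonneg hnn (sumSq_nonneg x)) (add_nonneg ha.le hb)]
      rw [← ENNReal.ofReal_add (Finset.sum_nonneg fun s _ => add_nonneg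
        (arrival_mul_sumSq_nonneg hlam hD x s) (completion_mul_sumSq_nonneg hμF hμS x s))
        (by positivity)]
      exact ENNReal.ofReal_le_ofReal hd)
  refine ⟨π, hπ, fun htop => hfin ?_⟩
  have e : ∀ x : QState kF kS, π x * (ENNReal.ofReal ε * ((∑ s, x s : ℕ) : ℝ≥0∞)) =
      ENNReal.ofReal ε * (π x * ((∑ s, x s : ℕ) : ℝ≥0∞)) := fun x => by ring
  simp_rw [e]
  rw [ENNReal.tsum_mul_left, htop, ENNReal.mul_top hε0]

theorem isStable_of_isStationary (hk : 0 < kF) (hlam : 0 < lam) (hμF : 0 < μF) (hμS : 0 < μS)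
    (hD : IsDispatchRule D) {π : QState kF kS → ℝ≥0∞}
    (hπ : Chain.IsStationary (queueRate lam μF μS D) π) : IsStable (queueRate lam μF μS D) := by
  intro x hx
  obtain ⟨y, hy⟩ : ∃ y, π y ≠ 0 := by
    by_contra! h
    have := hπ.total
    simp [h] at this
  have h0 : π (emptyState kF kS) ≠ 0 := hπ.ne_zero_of_reachable hy
    (reachable_of_le hμF hμS fun s => Nat.zero_le (y s))
  exact hπ.positiveRecurrent (exitRate_ne_zero hk hlam hD)
    (fun x => ne_top_of_le_ne_top (by simp) (exitRate_le hlam hμF hμS hD x))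
    (hπ.ne_zero_of_reachable h0 hx)

theorem continuous_queueRate {P : Type*} [TopologicalSpace P]
    {D : P → QState kF kS → Server kF kS → ℝ} (hD : ∀ x s, Continuous fun p => D p x s)
    (x y : QState kF kS) : Continuous fun p => queueRate lam μF μS (D p) x y := by
  unfold queueRate
  refine continuous_finsetSum _ fun s _ => Continuous.add ?_ continuous_const
  split_ifs
  · exact ENNReal.continuous_ofReal.comp (continuous_const.mul (hD x s))
  · exact continuous_const

theorem continuous_exitRate_queueRate {P : Type*} [TopologicalSpace P]
    {D : P → QState kF kS → Server kF kS → ℝ} (hD : ∀ x s, Continuous fun p => D p x s)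
    (x : QState kF kS) : Continuous fun p => Chain.exitRate (queueRate lam μF μS (D p)) x := by
  simp only [exitRate_queueRate]
  exact continuous_finsetSum _ fun s _ =>
    (ENNReal.continuous_ofReal.comp (continuous_const.mul (hD x s))).add continuous_const

theorem exitRate_queueRate_ne_top (x : QState kF kS) :
    Chain.exitRate (queueRate lam μF μS D) x ≠ ∞ := by
  rw [exitRate_queueRate]
  refine ENNReal.sum_ne_top.2 fun s _ => ENNReal.add_ne_top.2 ⟨by simp, ?_⟩
  split_ifs <;> simp

end Stability

section Policies

variable {kF kS dF dS : ℕ} {lam μF μS : ℝ} {pol : Policy}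

theorem reachable_policyRate (hdF : 1 ≤ dF) (hdFk : dF ≤ kF) (hdS : 1 ≤ dS) (hdSk : dS ≤ kS)
    (hμF : 0 < μF) (hμS : 0 < μS) (hlam : 0 < lam) {pF pS : ℝ} (hpF : pF ∈ Set.Ioo (0 : ℝ) 1)
    (hpS : pS ∈ Set.Ioc (0 : ℝ) 1) (x : QState kF kS) :
    Chain.Reachable (policyRate lam μF μS pol dF dS pF pS) (emptyState kF kS) x := by
  have hk : 0 < kF := hdF.trans hdFk
  have hpF' := Set.Ioo_subset_Icc_self hpF
  have hpS' := Set.Ioc_subset_Icc_self hpS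
  set M := ∑ s, x s + 1 with hM
  have hfast : ∀ (y : QState kF kS) (L : ℕ), (L = 1 ∨ ∀ j, 0 < y (Sum.inr j)) →
      ∀ s ∈ (Finset.univ.map Function.Embedding.inl : Finset (Server kF kS)), y s < L →
      (∀ t ∈ (Finset.univ.map Function.Embedding.inl : Finset (Server kF kS)), y s ≤ y t) →
      0 < dispatch pol dF dS pF pS y s := by
    intro y L hL s hs hsL hmin
    obtain ⟨i, -, rfl⟩ := Finset.mem_map.1 hs
    refine dispatch_fast_pos hdF hdFk hdSk hpF' hpS' hpF.1
      (fun i' => hmin _ (Finset.mem_map_of_mem _ (Finset.mem_univ i'))) ?_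
    rcases hL with rfl | hL
    · exact Or.inl (Nat.lt_one_iff.1 hsL)
    · exact Or.inr hL
  obtain ⟨y₁, -, hr₁, hy₁⟩ := exists_reachable_ge (lam := lam) (μF := μF) (μS := μS)
    (D := dispatch pol dF dS pF pS) hk hlam (Finset.univ.map Function.Embedding.inl) 1
    (emptyState kF kS) fun y _ => hfast y 1 (Or.inl rfl)
  have hy₁' : ∀ i, 0 < y₁ (Sum.inl i) := fun i =>
    hy₁ _ (Finset.mem_map_of_mem Function.Embedding.inl (Finset.mem_univ i))
  obtain ⟨y₂, -, hr₂, hy₂⟩ := exists_reachable_ge (lam := lam) (μF := μF) (μS := μS)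
    (D := dispatch pol dF dS pF pS) hk hlam (Finset.univ.map Function.Embedding.inr) M y₁ (by
      intro y hy s hs _ hmin
      obtain ⟨j, -, rfl⟩ := Finset.mem_map.1 hs
      exact dispatch_slow_pos hdFk hdS hdSk hpF' hpS' hpF.2 hpS.1
        (fun j' => hmin _ (Finset.mem_map_of_mem _ (Finset.mem_univ j')))
        fun i => (hy₁' i).trans_le (hy _))
  have hy₂' : ∀ j, M ≤ y₂ (Sum.inr j) := fun j =>
    hy₂ _ (Finset.mem_map_of_mem Function.Embedding.inr (Finset.mem_univ j))
  obtain ⟨y₃, h₂₃, hr₃, hy₃⟩ := exists_reachable_ge (lam := lam) (μF := μF) (μS := μS)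
    (D := dispatch pol dF dS pF pS) hk hlam (Finset.univ.map Function.Embedding.inl) M y₂
    fun y hy => hfast y M (Or.inr fun j => (Nat.succ_pos _).trans_le ((hy₂' j).trans (hy _)))
  have hxy : x ≤ y₃ := by
    intro s
    have hs : x s ≤ M := (Finset.single_le_sum (f := x) (fun _ _ => Nat.zero_le _)
      (Finset.mem_univ s)).trans (Nat.le_succ _)
    cases s with
    | inl i =>
      exact hs.trans (hy₃ _ (Finset.mem_map_of_mem Function.Embedding.inl (Finset.mem_univ i)))
    | inr j => exact hs.trans ((hy₂' j).trans (h₂₃ _))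
  exact ((hr₁.trans hr₂).trans hr₃).trans (reachable_of_le hμF hμS hxy)

theorem load_dispatch_le (hdF : 1 ≤ dF) (hdFk : dF ≤ kF) (hdS : 1 ≤ dS) (hdSk : dS ≤ kS)
    {pF : ℝ} (hpF : pF ∈ Set.Icc (0 : ℝ) 1) (hF : ((kF : ℝ) + kS) * pF = μF * kF)
    (hS : ((kF : ℝ) + kS) * (1 - pF) = μS * kS) (x : QState kF kS) :
    ((kF : ℝ) + kS) * ∑ s, dispatch pol dF dS pF 1 x s * (x s : ℝ) ≤
      ∑ s, serviceRate μF μS s * (x s : ℝ) := by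
  have hkF : (kF : ℝ) ≠ 0 := by exact_mod_cast Nat.one_le_iff_ne_zero.1 (hdF.trans hdFk)
  have hkS : (kS : ℝ) ≠ 0 := by exact_mod_cast Nat.one_le_iff_ne_zero.1 (hdS.trans hdSk)
  have h := mul_le_mul_of_nonneg_left (sum_dispatch_mul_le (pol := pol) hdF hdFk hdS hdSk hpF x)
    (by positivity : (0 : ℝ) ≤ (kF : ℝ) + kS)
  refine h.trans_eq ?_
  simp only [Fintype.sum_sum_type, serviceRate, Sum.elim_inl, Sum.elim_inr, ← Finset.mul_sum]
  rw [mul_add, ← mul_assoc, ← mul_assoc, hF, hS]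
  field_simp

theorem exists_isOptimal {p : ℝ × ℝ} (hp : p ∈ Set.Icc (0 : ℝ) 1 ×ˢ Set.Icc (0 : ℝ) 1)
    {π : QState kF kS → ℝ≥0∞}
    (hπ : Chain.IsStationary (policyRate lam μF μS pol dF dS p.1 p.2) π)
    (hfin : ∑' x, π x * ((∑ s, x s : ℕ) : ℝ≥0∞) ≠ ∞) :
    ∃ pF pS : ℝ, IsOptimal kF kS lam μF μS pol dF dS pF pS := by
  have hc := fun (x : QState kF kS) s => continuous_dispatch (pol := pol) (dF := dF) (dS := dS) x s
  obtain ⟨p', hp', π', hπ', -, hmin⟩ := Chain.exists_minimal_stationary_mean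
    (isCompact_Icc.prod isCompact_Icc)
    (q := fun p : ℝ × ℝ => policyRate (kF := kF) (kS := kS) lam μF μS pol dF dS p.1 p.2)
    (W := fun x => ((∑ s, x s : ℕ) : ℝ≥0∞))
    (continuous_queueRate hc) (fun _ => queueRate_ne_top) (continuous_exitRate_queueRate hc)
    (fun _ => exitRate_queueRate_ne_top)
    (fun y => ⟨predecessors y, fun _ _ hx => queueRate_eq_zero hx⟩)
    (fun x => ENNReal.natCast_ne_top _)
    (fun n => by simpa using finite_setOf_mul_sum_le one_ne_zero ENNReal.one_ne_top n)
    ⟨p, hp, π, hπ, hfin⟩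
  refine ⟨p'.1, p'.2, hp'.1, hp'.2, fun pF hpF pS hpS => ?_⟩
  refine le_iInf₂ fun π'' hπ'' => (iInf₂_le π' hπ').trans ?_
  gcongr ?_ / _
  exact hmin (pF, pS) ⟨hpF, hpS⟩ π'' hπ''

theorem exists_isStationary_of_meanResponseTime_ne_top {q : QState kF kS → QState kF kS → ℝ≥0∞}
    (h : meanResponseTime lam q ≠ ∞) : ∃ π, Chain.IsStationary q π := by
  by_contra! hno
  refine h ?_
  simp [meanResponseTime, hno]

theorem meanResponseTime_ne_top (hk : 0 < kF) (hlam : 0 < lam)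
    {q : QState kF kS → QState kF kS → ℝ≥0∞} {π : QState kF kS → ℝ≥0∞}
    (hπ : Chain.IsStationary q π) (hfin : ∑' x, π x * ((∑ s, x s : ℕ) : ℝ≥0∞) ≠ ∞) :
    meanResponseTime lam q ≠ ∞ := by
  have ha : 0 < lam * ((kF : ℝ) + kS) := by positivity
  exact ne_top_of_le_ne_top (ENNReal.div_ne_top hfin (ENNReal.ofReal_pos.2 ha).ne')
    (iInf₂_le π hπ)

end Policies

theorem theorem1 (kF kS dF dS : ℕ) (μF μS : ℝ)
    (hdF : 1 ≤ dF) (hdFk : dF ≤ kF) (hdS : 1 ≤ dS) (hdSk : dS ≤ kS)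
    (hμF : 0 < μF) (hμS : 0 < μS)
    (hcap : μF * ((kF : ℝ) / ((kF : ℝ) + kS)) + μS * ((kS : ℝ) / ((kF : ℝ) + kS)) = 1)
    (lam : ℝ) (hlam : 0 < lam) :
    (lam < 1 → ∀ pol : Policy,
      ((∀ x, Chain.Reachable
          (policyRate lam μF μS pol dF dS (μF * ((kF : ℝ) / ((kF : ℝ) + kS))) 1)
          (emptyState kF kS) x) ∧
        IsStable (kF := kF) (kS := kS)
          (policyRate lam μF μS pol dF dS (μF * ((kF : ℝ) / ((kF : ℝ) + kS))) 1)) ∧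
      (∃ pF pS : ℝ, IsOptimal kF kS lam μF μS pol dF dS pF pS) ∧
      (∀ pF pS : ℝ, IsOptimal kF kS lam μF μS pol dF dS pF pS →
        IsStable (kF := kF) (kS := kS) (policyRate lam μF μS pol dF dS pF pS))) ∧
    (1 ≤ lam → ∀ D : QState kF kS → Server kF kS → ℝ, IsDispatchRule D →
      ¬ IsStable (queueRate lam μF μS D)) := by
  have hkF : 0 < kF := hdF.trans hdFk
  have hkS : 0 < kS := hdS.trans hdSk
  have hkF' : (0 : ℝ) < kF := by exact_mod_cast hkF
  have hkS' : (0 : ℝ) < kS := by exact_mod_cast hkS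
  have hk : (0 : ℝ) < (kF : ℝ) + kS := by positivity
  have hF0 : 0 < μF * ((kF : ℝ) / ((kF : ℝ) + kS)) := by positivity
  have hS0 : 0 < μS * ((kS : ℝ) / ((kF : ℝ) + kS)) := by positivity
  have hF : ((kF : ℝ) + kS) * (μF * ((kF : ℝ) / ((kF : ℝ) + kS))) = μF * kF := by field_simp
  have hS : ((kF : ℝ) + kS) * (μS * ((kS : ℝ) / ((kF : ℝ) + kS))) = μS * kS := by field_simp
  refine ⟨fun hlam1 pol => ?_, fun h1 D hD => not_isStable_of_overload hkF hlam hμF hμS ?_ hD⟩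
  · set p := μF * ((kF : ℝ) / ((kF : ℝ) + kS)) with hp
    have hq : μS * ((kS : ℝ) / ((kF : ℝ) + kS)) = 1 - p := by linarith
    have hp1 : p < 1 := by linarith
    rw [hq] at hS
    have hpI : p ∈ Set.Icc (0 : ℝ) 1 := ⟨hF0.le, hp1.le⟩
    have h1I : (1 : ℝ) ∈ Set.Icc (0 : ℝ) 1 := ⟨zero_le_one, le_rfl⟩
    have hD : IsDispatchRule (kF := kF) (kS := kS) (dispatch pol dF dS p 1) :=
      isDispatchRule_dispatch hdF hdFk hdS hdSk hpI h1I
    obtain ⟨π, hπ, hfin⟩ := exists_isStationary_finite_mean hkF hlam hlam1 hμF hμS hD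
      (load_dispatch_le hdF hdFk hdS hdSk hpI hF hS)
    refine ⟨⟨reachable_policyRate hdF hdFk hdS hdSk hμF hμS hlam ⟨hF0, hp1⟩ ⟨one_pos, le_rfl⟩,
      isStable_of_isStationary hkF hlam hμF hμS hD hπ⟩,
      exists_isOptimal (p := (p, 1)) ⟨hpI, h1I⟩ hπ hfin, fun pF pS hopt => ?_⟩
    obtain ⟨π', hπ'⟩ := exists_isStationary_of_meanResponseTime_ne_top
      (ne_top_of_le_ne_top (meanResponseTime_ne_top hkF hlam hπ hfin) (hopt.2.2 p hpI 1 h1I))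
    exact isStable_of_isStationary hkF hlam hμF hμS
      (isDispatchRule_dispatch hdF hdFk hdS hdSk hopt.1 hopt.2.1) hπ'
  · have hsum := congrArg (((kF : ℝ) + kS) * ·) hcap
    simp only [mul_add ((kF : ℝ) + kS), hF, hS, mul_one] at hsum
    rw [mul_comm (kF : ℝ), mul_comm (kS : ℝ), hsum]
    exact le_mul_of_one_le_left hk.le h1

end
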